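/- All graphs are finite and simple. Let $G$ be a graph. A list assignment $L$ for $G$ assigns a finite set $L(v)$ of colors to every vertex $v$; it has lists of size $k$ if $|L(v)|=k$ for all $v\in V(G)$. An $L$-coloring is a proper coloring $\varphi$ of $G$ with $\varphi(v)\in L(v)$ for all $v\in V(G)$. A weighted request $w$ for $G$ and $L$ assigns a non-negative real number $w(v,c)$ to every pair $(v,c)$ with $v\in V(G)$ and $c\in L(v)$. The graph $G$ is weighted $\varepsilon$-flexible for lists of size $k$ if for every list assignment $L$ with lists of size $k$ and every weighted request $w$ there is an $L$-coloring $\varphi$ of $G$ such that \[ \sum_{v\in V(G)} w(v,\varphi(v))\ \ge\ \varepsilon\cdot\sum_{v\in V(G)}\ \sum_{c\in L(v)} w(v,c). \] **Theorem 1.4.** There exists $\varepsilon>0$ such that every planar graph $G$ that contains no $4$-cycle as a (not necessarily induced) subgraph, and in which any two distinct $3$-cycles are at distance at least $2$ (that is, every path joining a vertex of one to a vertex of the other has length at least $2$; in particular, distinct $3$-cycles are disjoint), is weighted $\varepsilon$-flexible for lists of size $4$. -/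

import Mathlib

universe u v

/-! ### Planarity

A graph is drawn on an oriented surface by prescribing, around every vertex, the cyclic order of
the darts (oriented edges) leaving it.  Every cellular embedding into an oriented closed surface
arises in this way, with one surface for each connected component of the graph.  The faces are read
off from the rotations, and the genus of the embedding from the Euler characteristic.  The graph is
planar if it has such an embedding into the sphere (one sphere for each component). -/

/-- A rotation system: a permutation of the darts of `G` whose cycles are exactly the sets of darts
leaving a given vertex; `next d` is the successor of `d` in the cyclic order around its origin. -/
structure SimpleGraph.RotationSystem {V : Type u} (G : SimpleGraph V) where
  next : Equiv.Perm G.Dart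
  next_fst : ∀ d, (next d).fst = d.fst
  sameCycle_of_fst_eq : ∀ d d', d.fst = d'.fst → next.SameCycle d d'

namespace SimpleGraph.RotationSystem

variable {V : Type u} {G : SimpleGraph V}

/-- The face-tracing permutation: traverse the dart `d` from `x` to `y`, then leave `y` along the
dart that follows the reversal of `d` in the cyclic order around `y`. -/
def faceNext (R : G.RotationSystem) : Equiv.Perm G.Dart :=
  (Function.Involutive.toPerm Dart.symm Dart.symm_involutive).trans R.next

/-- The facial walks of the embedding: the orbits of the face-tracing permutation. -/
def FacialWalk (R : G.RotationSystem) : Type u :=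
  Quotient (Equiv.Perm.SameCycle.setoid R.faceNext)

/-- The number of faces of the embedding (of a finite graph).  Each facial walk bounds one face, and
a component that is an isolated vertex, which has no darts, has exactly one face. -/
noncomputable def numFaces (R : G.RotationSystem) : ℕ :=
  Nat.card R.FacialWalk + {x : V | G.IsIsolated x}.ncard

/-- The Euler characteristic `|V| - |E| + |F|` of the surface into which the rotation system embeds
a finite graph, i.e. the sum of the Euler characteristics of the closed surfaces that carry the
components. -/
noncomputable def eulerChar (R : G.RotationSystem) : ℤ :=
  (Nat.card V : ℤ) - (G.edgeSet.ncard : ℤ) + (R.numFaces : ℤ)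

/-- Twice the total genus of the embedding: a connected closed oriented surface of genus `g` has Euler
characteristic `2 - 2 * g`, so that twice the sum of the genera of the surfaces that carry the
components is `2 * (number of components) - eulerChar`. -/
noncomputable def twiceGenus (R : G.RotationSystem) : ℤ :=
  2 * (Nat.card G.ConnectedComponent : ℤ) - R.eulerChar

end SimpleGraph.RotationSystem

/-- A finite graph is planar if it has an embedding of genus `0`.  As the genus of every surface is
nonnegative, the total genus is `0` if and only if each component is embedded into a sphere. -/
def SimpleGraph.IsPlanar {V : Type u} (G : SimpleGraph V) : Prop :=
  ∃ R : G.RotationSystem, R.twiceGenus = 0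

/-- Any two distinct `3`-cycles of `G` are at distance at least `d`; a `3`-cycle is given by its
vertex set.  The distance is infinite between vertices of different components. -/
def SimpleGraph.TriangleDistanceAtLeast {V : Type u} (G : SimpleGraph V) (d : ℕ) : Prop :=
  ∀ s t : Finset V, G.IsNClique 3 s → G.IsNClique 3 t → s ≠ t →
    ∀ x ∈ s, ∀ y ∈ t, (d : ℕ∞) ≤ G.edist x y

/-! ### List colorings and weighted requests -/

/-- `w` assigns a nonnegative weight to each pair of a vertex `x` and a color `c ∈ L x`.  The values
of `w` on other pairs are irrelevant. -/
def IsWeightedRequest {V : Type u} {C : Type v} (L : V → Finset C) (w : V → C → ℝ) : Prop :=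
  ∀ x, ∀ c ∈ L x, 0 ≤ w x c

/-- Some `L`-coloring of `G` (a proper coloring with colors from the lists) satisfies at least an
`ε`-fraction of the total weight of `w`. -/
def SimpleGraph.IsSatisfiable {V : Type u} [Fintype V] (G : SimpleGraph V) {C : Type v}
    (L : V → Finset C) (w : V → C → ℝ) (ε : ℝ) : Prop :=
  ∃ φ : G.Coloring C, (∀ x, φ x ∈ L x) ∧ ε * ∑ x, ∑ c ∈ L x, w x c ≤ ∑ x, w x (φ x)

/-- `G` with the list assignment `L` is weighted `ε`-flexible. -/
def SimpleGraph.IsWeightedFlexibleWith {V : Type u} [Fintype V] (G : SimpleGraph V) {C : Type v}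
    (L : V → Finset C) (ε : ℝ) : Prop :=
  ∀ w : V → C → ℝ, IsWeightedRequest L w → G.IsSatisfiable L w ε

/-- `G` is weighted `ε`-flexible for lists of size `k`, for colors from arbitrary types. -/
def SimpleGraph.IsWeightedFlexible {V : Type u} [Fintype V] (G : SimpleGraph V)
    (ε : ℝ) (k : ℕ) : Prop :=
  ∀ (C : Type v) (L : V → Finset C), (∀ x, (L x).card = k) → G.IsWeightedFlexibleWith L ε

/-! A planar graph `G` as in the theorem is colored in the reverse of an order in which small sets
of vertices are removed one after the other, and the colors are chosen at random.

Let `Z` be the set of vertices that have not been removed. A set `S ⊆ Z` of at most three vertices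
may be removed next if it is reducible (`SimpleGraph.IsReducible`): each vertex of `S` has at most
two neighbors in `Z \ S`, so that at least two colors of its list are still available, `S` can be
colored even if one of its vertices has a single color available, and no vertex outside `Z` has
two neighbors in `S`. A coloring of `Z \ S` has at most `64` extensions to `S`. If one of them is
chosen at random, then by induction a set `I` of neighbors of a vertex outside `Z` avoids any
given color with probability at least `64 ^ (-|I|)`. Applied to the at most two neighbors in `Z \
S` of a vertex `x` of `S`, this shows that `x` receives each color of its list with probability at
least `64⁻³` (`SimpleGraph.IsReducible.hasSpreadFamily`). The expectation of the satisfied weight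
is then at least `64⁻³` times the total weight, and some coloring does as well as the average
(`SimpleGraph.HasSpreadFamily.isWeightedFlexibleWith`).

It remains to find a reducible set in each nonempty `Z`. With degrees taken in `G[Z]`, there are
three of them: a vertex of degree at most two, two adjacent vertices of degree three, and an
induced path of three vertices of degrees three, four and three. The last two are reducible unless
an edge of the configuration is in a triangle of `G` whose third vertex has been removed already;
as triangles of `G` are far apart, this does not happen near a triangle of `G[Z]`.

If `G[Z]` contains none of them, then it is refuted by discharging
(`SimpleGraph.IsCritical.eq_empty`). Each vertex `v` has charge `deg v - 4` and each face of
length `ℓ` has charge `ℓ - 4`; by Euler's formula the sum is negative. The faces have length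
three, five, or at least six. A face that is not a triangle sends one third to each incident
vertex of degree three that is on no triangular face. It sends `n / 3` across each edge to a
triangular face of degree sum `13 - n`, where `n ≤ 2`. This makes up for all deficits, and faces
of length at least six send at most one third for each of their corners. A face of length five
stays nonnegative by the absence of the three configurations
(`SimpleGraph.SubRotation.penta_pay`).

Euler's formula is needed for the subgraphs `G[Z]`, that is, planarity has to be inherited by
subgraphs. This holds because deleting an edge from a rotation system does not increase the genus
(`SimpleGraph.SubRotation.excess_deleteEdge_le`). -/

/-! ### Counting the cycles of a permutation -/

section Orbits

variable {α : Type*}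

/-- If two equivalence relations `r` and `s` are such that `s`-equivalent elements are equivalent
after the classes of `x` and `y` under `r` have been merged, then `r` has at most one class more
than `s`. -/
theorem Setoid.card_quotient_le_add_one [Finite α] (r s : Setoid α) (x y : α)
    (h : ∀ a b, s a b → r a b ∨ (r a x ∧ r b y) ∨ (r a y ∧ r b x)) :
    Nat.card (Quotient r) ≤ Nat.card (Quotient s) + 1 := by
  classical
  rw [← Finite.card_option]
  let f : Quotient r → Option (Quotient s) := fun q =>
    if q = Quotient.mk r x then none else some (Quotient.mk s q.out)
  refine Nat.card_le_card_of_injective f fun p q hpq => ?_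
  by_cases hp : p = Quotient.mk r x <;> by_cases hq : q = Quotient.mk r x
  · rw [hp, hq]
  · simp [f, hp, hq] at hpq
  · simp [f, hp, hq] at hpq
  · simp only [f, hp, hq, if_false, Option.some.injEq] at hpq
    have key : ∀ z : Quotient r, z ≠ Quotient.mk r x → ¬ r z.out x := fun z hz hzx =>
      hz (by rw [← Quotient.out_eq z]; exact Quotient.sound hzx)
    rcases h _ _ (Quotient.exact hpq) with h1 | h1 | h1
    · rw [← Quotient.out_eq p, ← Quotient.out_eq q]; exact Quotient.sound h1
    · exact absurd h1.1 (key p hp)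
    · exact absurd h1.2 (key q hq)

/-- Merging the classes of `x` and `y` in an equivalence relation gives a transitive relation. -/
theorem Setoid.merge_trans (r : Setoid α) (x y : α) {a b c : α}
    (h₁ : r a b ∨ (r a x ∧ r b y) ∨ (r a y ∧ r b x))
    (h₂ : r b c ∨ (r b x ∧ r c y) ∨ (r b y ∧ r c x)) :
    r a c ∨ (r a x ∧ r c y) ∨ (r a y ∧ r c x) := by
  have t : ∀ {a b c}, r a b → r b c → r a c := fun h h' => r.trans' h h'
  have s : ∀ {a b}, r a b → r b a := fun h => r.symm' h
  rcases h₁ with h | ⟨h, h'⟩ | ⟨h, h'⟩ <;> rcases h₂ with k | ⟨k, k'⟩ | ⟨k, k'⟩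
  · exact .inl (t h k)
  · exact .inr (.inl ⟨t h k, k'⟩)
  · exact .inr (.inr ⟨t h k, k'⟩)
  · exact .inr (.inl ⟨h, t (s k) h'⟩)
  · exact .inl (t (t h (t (s k) h')) (s k') )
  · exact .inl (t h (s k'))
  · exact .inr (.inr ⟨h, t (s k) h'⟩)
  · exact .inl (t h (s k'))
  · exact .inl (t (t h (t (s k) h')) (s k') )

namespace Equiv.Perm

/-- The number of cycles of a permutation, fixed points included. -/
noncomputable def numOrbits (π : Perm α) : ℕ :=
  Nat.card (Quotient (SameCycle.setoid π))

/-- Composition with a transposition merges at most two cycles. -/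
theorem numOrbits_le_swap_mul [Finite α] [DecidableEq α] (π : Perm α) (a b : α) :
    numOrbits (swap a b * π) ≤ numOrbits π + 1 ∧ numOrbits π ≤ numOrbits (swap a b * π) + 1 := by
  have key : ∀ π : Perm α, numOrbits (swap a b * π) ≤ numOrbits π + 1 := by
    intro π
    refine Setoid.card_quotient_le_add_one _ _ a b fun c d hcd => ?_
    obtain ⟨n, rfl⟩ := SameCycle.exists_nat_pow_eq hcd
    clear hcd
    induction n with
    | zero => exact .inl (SameCycle.refl _ _)
    | succ n ih =>
      refine Setoid.merge_trans _ a b ih ?_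
      set e := (π ^ n) c
      have he : (π ^ (n + 1)) c = π e := by rw [pow_succ']; rfl
      have hstep : SameCycle (swap a b * π) e (swap a b (π e)) := ⟨1, by simp⟩
      rw [he]
      by_cases h1 : π e = a
      · rw [h1, swap_apply_left] at hstep
        exact .inr (.inr ⟨hstep, h1 ▸ SameCycle.refl _ _⟩)
      · by_cases h2 : π e = b
        · rw [h2, swap_apply_right] at hstep
          exact .inr (.inl ⟨hstep, h2 ▸ SameCycle.refl _ _⟩)
        · rw [swap_apply_of_ne_of_ne h1 h2] at hstep
          exact .inl hstep
  refine ⟨key π, ?_⟩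
  have := key (swap a b * π)
  rwa [← mul_assoc, swap_mul_self, one_mul] at this

/-- Composition with a transposition of two points of one cycle splits this cycle. -/
theorem numOrbits_lt_swap_mul [Finite α] [DecidableEq α] {π : Perm α} {a b : α} (hab : a ≠ b)
    (h : π.SameCycle a b) : numOrbits π + 1 ≤ numOrbits (swap a b * π) := by
  classical
  have hex : ∃ n, (π ^ n) a = b := SameCycle.exists_nat_pow_eq h
  set m := Nat.find hex with hm
  have hmb : (π ^ m) a = b := Nat.find_spec hex
  have hmin : ∀ i < m, (π ^ i) a ≠ b := fun i hi => Nat.find_min hex hi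
  have hm0 : 0 < m := by
    rcases Nat.eq_zero_or_pos m with h0 | h0
    · rw [h0] at hmb; exact absurd hmb hab
    · exact h0
  have hna : ∀ i, 0 < i → i < m → (π ^ i) a ≠ a := by
    intro i hi him hia
    apply hmin (m - i) (by omega)
    have : (π ^ m) a = (π ^ (m - i)) ((π ^ i) a) := by
      rw [← mul_apply, ← pow_add]; congr 2; omega
    rw [← hmb, this, hia]
  have orb : ∀ n, ∃ i < m, ((swap a b * π) ^ n) a = (π ^ i) a := by
    intro n
    induction n with
    | zero => exact ⟨0, hm0, rfl⟩
    | succ n ih =>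
      obtain ⟨i, hi, hie⟩ := ih
      rw [pow_succ', mul_apply, hie, mul_apply, ← mul_apply π, ← pow_succ']
      by_cases hi' : i + 1 = m
      · exact ⟨0, hm0, by rw [hi', hmb, swap_apply_right]; rfl⟩
      · exact ⟨i + 1, by omega, swap_apply_of_ne_of_ne (hna _ (by omega) (by omega))
          (hmin _ (by omega))⟩
  have hnot : ¬ SameCycle (swap a b * π) a b := by
    intro hs
    obtain ⟨n, hn⟩ := SameCycle.exists_nat_pow_eq hs
    obtain ⟨i, hi, hie⟩ := orb n
    exact hmin i hi (hie ▸ hn)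
  have hle : ∀ c d, SameCycle (swap a b * π) c d → SameCycle π c d := by
    intro c d hcd
    obtain ⟨n, rfl⟩ := SameCycle.exists_nat_pow_eq hcd
    clear hcd
    induction n with
    | zero => exact SameCycle.refl _ _
    | succ n ih =>
      rw [pow_succ', mul_apply]
      refine ih.trans ?_
      set e := ((swap a b * π) ^ n) c
      have he : SameCycle π e (π e) := ⟨1, by simp⟩
      rw [mul_apply]
      by_cases h1 : π e = a
      · rw [h1, swap_apply_left]; rw [h1] at he; exact he.trans h
      · by_cases h2 : π e = b
        · rw [h2, swap_apply_right]; rw [h2] at he; exact he.trans h.symm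
        · rwa [swap_apply_of_ne_of_ne h1 h2]
  let f : Quotient (SameCycle.setoid (swap a b * π)) → Quotient (SameCycle.setoid π) :=
    Quotient.map id hle
  have hf : Function.Surjective f := fun q => by
    induction q using Quotient.inductionOn with
    | _ c => exact ⟨Quotient.mk _ c, rfl⟩
  have hcard := Nat.card_le_card_of_surjective f hf
  refine Nat.lt_of_le_of_ne hcard fun heq => hnot ?_
  have hbij : Function.Bijective f :=
    (Nat.bijective_iff_surjective_and_card f).2 ⟨hf, heq.symm⟩
  exact Quotient.exact (hbij.1 (Quotient.sound h : f (Quotient.mk _ a) = f (Quotient.mk _ b)))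

theorem card_filter_sameCycle [Fintype α] [DecidableEq α] (π : Perm α) (a : α)
    [DecidablePred (π.SameCycle a)] :
    (Finset.univ.filter (π.SameCycle a)).card = Function.minimalPeriod π a := by
  have : Finset.univ.filter (π.SameCycle a) =
      (Finset.range (Function.minimalPeriod π a)).image fun i => π^[i] a := by
    ext b
    simp only [Finset.mem_filter, Finset.mem_univ, true_and, Finset.mem_image, Finset.mem_range]
    constructor
    · intro h
      obtain ⟨n, rfl⟩ := SameCycle.exists_nat_pow_eq h
      refine ⟨n % Function.minimalPeriod π a, Nat.mod_lt _ ?_, ?_⟩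
      · exact Function.minimalPeriod_pos_of_mem_periodicPts
          (Function.Injective.mem_periodicPts π.injective a)
      · rw [Function.iterate_mod_minimalPeriod_eq, iterate_eq_pow]
    · rintro ⟨i, -, rfl⟩
      exact ⟨i, by rw [iterate_eq_pow, zpow_natCast]⟩
  rw [this, Finset.card_image_of_injOn, Finset.card_range]
  intro i hi j hj hij
  exact Function.iterate_injOn_Iio_minimalPeriod (by simpa using hi) (by simpa using hj) hij

/-- Every cycle contributes a total of `1` to the sum of the reciprocals of the cycle lengths. -/
theorem numOrbits_eq_sum [Fintype α] (π : Perm α) :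
    (numOrbits π : ℚ) = ∑ a, 1 / (Function.minimalPeriod π a : ℚ) := by
  classical
  let g : α → Quotient (SameCycle.setoid π) := Quotient.mk _
  have hfib : ∀ q, ∑ a with g a = q, 1 / (Function.minimalPeriod π a : ℚ) = 1 := by
    intro q
    obtain ⟨a, rfl⟩ : ∃ a, g a = q := Quotient.exists_rep q
    have hset : Finset.univ.filter (fun b => g b = g a) = Finset.univ.filter (π.SameCycle a) := by
      ext b
      simp only [Finset.mem_filter, Finset.mem_univ, true_and]
      exact ⟨fun h => (Quotient.exact h).symm, fun h => Quotient.sound h.symm⟩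
    have hconst : ∀ b ∈ Finset.univ.filter (π.SameCycle a),
        1 / (Function.minimalPeriod π b : ℚ) = 1 / (Function.minimalPeriod π a : ℚ) := by
      intro b hb
      have hb' : π.SameCycle a b := by simpa using hb
      rw [← card_filter_sameCycle π a, ← card_filter_sameCycle π b]
      congr 3
      ext c
      simp only [Finset.mem_filter, Finset.mem_univ, true_and]
      exact ⟨fun h => hb'.trans h, fun h => hb'.symm.trans h⟩
    rw [hset, Finset.sum_congr rfl hconst, Finset.sum_const, card_filter_sameCycle, nsmul_eq_mul]
    have : 0 < Function.minimalPeriod π a := Function.minimalPeriod_pos_of_mem_periodicPts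
          (Function.Injective.mem_periodicPts π.injective a)
    field_simp
  rw [← Finset.sum_fiberwise Finset.univ g, Finset.sum_congr rfl fun q _ => hfib q,
    Finset.sum_const, nsmul_eq_mul, mul_one, numOrbits, Nat.card_eq_fintype_card,
    Finset.card_univ]

end Equiv.Perm

end Orbits

/-! ### Embeddings of spanning subgraphs -/

namespace Equiv.Perm

variable {α : Type*} [DecidableEq α]

/-- The permutation that skips `x`: it fixes `x`, and on the other points it is the first return map
of `π`. -/
def skip (π : Perm α) (x : α) : Perm α := swap x (π x) * π

theorem skip_apply_self (π : Perm α) (x : α) : π.skip x x = x := by simp [skip]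

theorem skip_apply_of_ne {π : Perm α} {x a : α} (ha : a ≠ x) (h : π a ≠ x) :
    π.skip x a = π a :=
  swap_apply_of_ne_of_ne h fun h' => ha (π.injective h')

theorem skip_apply_of_eq {π : Perm α} {x a : α} (h : π a = x) : π.skip x a = π x := by
  simp [skip, h]

theorem SameCycle.skip [Finite α] {π : Perm α} {x a b : α} (ha : a ≠ x) (hb : b ≠ x)
    (h : π.SameCycle a b) : (π.skip x).SameCycle a b := by
  obtain ⟨n, rfl⟩ := SameCycle.exists_nat_pow_eq h
  have key : ∀ n, (π.skip x).SameCycle a (if (π ^ n) a = x then π x else (π ^ n) a) := by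
    intro n
    induction n with
    | zero => simp [ha, SameCycle.refl]
    | succ n ih =>
      rw [pow_succ', mul_apply]
      set e := (π ^ n) a
      by_cases he : e = x
      · simp only [he, if_true] at ih ⊢
        simpa using ih
      · simp only [he, if_false] at ih
        refine ih.trans ⟨1, ?_⟩
        by_cases he' : π e = x
        · simp [he', skip_apply_of_eq he']
        · simp [he', skip_apply_of_ne he he']
  simpa [hb] using key n

end Equiv.Perm

namespace SimpleGraph

variable {V : Type u} {G H : SimpleGraph V}

instance Dart.instFinite [Finite V] : Finite G.Dart :=
  Finite.of_injective (fun d => d.toProd) fun _ _ h => Dart.ext _ _ h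

/-- A rotation system for a spanning subgraph `H` of `G`, written as a permutation of all darts
of `G` that fixes the darts outside `H`. Keeping the set of darts fixed while edges are deleted
avoids transporting permutations between different types. -/
structure SubRotation (G H : SimpleGraph V) where
  le : H ≤ G
  next : Equiv.Perm G.Dart
  next_fst : ∀ d, (next d).fst = d.fst
  next_eq_self : ∀ d : G.Dart, ¬ H.Adj d.fst d.snd → next d = d
  sameCycle : ∀ d d' : G.Dart, H.Adj d.fst d.snd → H.Adj d'.fst d'.snd → d.fst = d'.fst →
    next.SameCycle d d'

namespace SubRotation

/-- The face-tracing permutation. A deleted edge contributes a cycle of length two, formed by its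
two darts. -/
def face (R : SubRotation G H) : Equiv.Perm G.Dart :=
  R.next * Function.Involutive.toPerm Dart.symm Dart.symm_involutive

theorem face_apply (R : SubRotation G H) (d : G.Dart) : R.face d = R.next d.symm := rfl

theorem face_fst (R : SubRotation G H) (d : G.Dart) : (R.face d).fst = d.snd := by
  rw [face_apply, R.next_fst]; rfl

theorem adj_next (R : SubRotation G H) {d : G.Dart} (h : H.Adj d.fst d.snd) :
    H.Adj (R.next d).fst (R.next d).snd := by
  by_contra hn
  have := R.next.injective (R.next_eq_self _ hn)
  rw [this] at hn
  exact hn h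

theorem adj_face (R : SubRotation G H) {d : G.Dart} (h : H.Adj d.fst d.snd) :
    H.Adj (R.face d).fst (R.face d).snd :=
  R.adj_next (d := d.symm) h.symm

/-- Twice the number of components minus the number of cycles of the face-tracing permutation and
the number of isolated vertices. Up to a constant depending on `G` only, this is twice the genus,
because each deleted edge lowers the number of edges by one and adds one cycle of length two. -/
noncomputable def excess (R : SubRotation G H) : ℤ :=
  2 * (Nat.card H.ConnectedComponent : ℤ) - (R.face.numOrbits : ℤ) -
    ({x : V | H.IsIsolated x}.ncard : ℤ)

section delete

theorem symm_ne_of_fst_eq {d a : G.Dart} (h : a.fst = d.fst) : a ≠ d.symm := by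
  rintro rfl
  exact d.adj.ne h.symm

theorem card_connectedComponent_deleteEdge [Finite V] (d : G.Dart) :
    Nat.card (H.deleteEdges {d.edge}).ConnectedComponent ≤
      Nat.card H.ConnectedComponent + 1 := by
  refine Setoid.card_quotient_le_add_one (H.deleteEdges {d.edge}).reachableSetoid
    H.reachableSetoid d.fst d.snd fun a b hab => ?_
  obtain ⟨p⟩ : H.Reachable a b := hab
  induction p with
  | nil => exact .inl (Reachable.refl _)
  | @cons a c b hac p ih =>
    refine Setoid.merge_trans (H.deleteEdges {d.edge}).reachableSetoid d.fst d.snd ?_ ih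
    by_cases he : s(a, c) = d.edge
    · rcases Sym2.eq_iff.1 (he : s(a, c) = s(d.fst, d.snd)) with ⟨rfl, rfl⟩ | ⟨rfl, rfl⟩
      · exact .inr (.inl ⟨Reachable.refl _, Reachable.refl _⟩)
      · exact .inr (.inr ⟨Reachable.refl _, Reachable.refl _⟩)
    · exact .inl (Adj.reachable (deleteEdges_adj.2 ⟨hac, he⟩))

theorem card_connectedComponent_deleteEdge_of_reachable (d : G.Dart)
    (h : (H.deleteEdges {d.edge}).Reachable d.fst d.snd) :
    Nat.card (H.deleteEdges {d.edge}).ConnectedComponent = Nat.card H.ConnectedComponent := by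
  have : (H.deleteEdges {d.edge}).Reachable = H.Reachable := by
    ext a b
    refine ⟨fun hab => hab.mono (deleteEdges_le _), ?_⟩
    rintro ⟨p⟩
    induction p with
    | nil => exact Reachable.refl _
    | @cons a c b hac p ih =>
      refine Reachable.trans ?_ ih
      by_cases he : s(a, c) = d.edge
      · rcases Sym2.eq_iff.1 (he : s(a, c) = s(d.fst, d.snd)) with ⟨rfl, rfl⟩ | ⟨rfl, rfl⟩
        exacts [h, h.symm]
      · exact Adj.reachable (deleteEdges_adj.2 ⟨hac, he⟩)
  unfold ConnectedComponent
  rw [this]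

/-- If the ends of the deleted edge are separated by its deletion, then the facial walk along one of
its darts has to come back along the other one. -/
theorem sameCycle_of_not_reachable [Finite V] (R : SubRotation G H) (d : G.Dart)
    (hd : H.Adj d.fst d.snd)
    (h : ¬ (H.deleteEdges {d.edge}).Reachable d.fst d.snd) :
    R.face.SameCycle d d.symm := by
  by_contra hns
  have key : ∀ n : ℕ, H.Adj ((R.face ^ (n + 1)) d).fst ((R.face ^ (n + 1)) d).snd ∧
      (H.deleteEdges {d.edge}).Reachable d.snd ((R.face ^ (n + 1)) d).fst := by
    intro n
    induction n with
    | zero =>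
      refine ⟨by simpa using R.adj_face hd, ?_⟩
      rw [zero_add, pow_one, R.face_fst]
    | succ n ih =>
      rw [pow_succ', Equiv.Perm.mul_apply]
      have hne : (R.face ^ (n + 1)) d ≠ d.symm := fun h => hns ⟨(n + 1 : ℕ), by rwa [zpow_natCast]⟩
      set a := (R.face ^ (n + 1)) d
      refine ⟨R.adj_face ih.1, ih.2.trans ?_⟩
      rw [R.face_fst]
      refine Adj.reachable (deleteEdges_adj.2 ⟨ih.1, fun he => ?_⟩)
      rcases dart_edge_eq_iff a d |>.1 he with h' | h'
      · rw [h'] at ih; exact h ih.2.symm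
      · exact hne h'
  have := (key (orderOf R.face - 1)).2
  rw [Nat.sub_add_cancel (orderOf_pos R.face), pow_orderOf_eq_one] at this
  exact h this.symm

variable [DecidableEq G.Dart]

theorem skip_skip_apply_symm (R : SubRotation G H) (d : G.Dart) :
    (R.next.skip d.symm).skip d d.symm = d.symm := by
  rw [Equiv.Perm.skip_apply_of_ne, Equiv.Perm.skip_apply_self]
  · exact (symm_ne_of_fst_eq rfl).symm
  · rw [Equiv.Perm.skip_apply_self]; exact (symm_ne_of_fst_eq rfl).symm

theorem skip_symm_apply (R : SubRotation G H) (d : G.Dart) :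
    R.next.skip d.symm d = R.next d :=
  Equiv.Perm.skip_apply_of_ne (symm_ne_of_fst_eq rfl) (symm_ne_of_fst_eq (R.next_fst d))

theorem skip_fst {π : Equiv.Perm G.Dart} (h : ∀ d, (π d).fst = d.fst) (x d : G.Dart) :
    (π.skip x d).fst = d.fst := by
  by_cases hd : d = x
  · rw [hd, Equiv.Perm.skip_apply_self]
  · by_cases hd' : π d = x
    · rw [Equiv.Perm.skip_apply_of_eq hd', h, ← hd', h]
    · rw [Equiv.Perm.skip_apply_of_ne hd hd', h]

/-- Deletion of the edge that carries the dart `d`. -/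
def deleteEdge [Finite V] (R : SubRotation G H) (d : G.Dart) :
    SubRotation G (H.deleteEdges {d.edge}) where
  le := (deleteEdges_le _).trans R.le
  next := (R.next.skip d.symm).skip d
  next_fst := skip_fst (skip_fst R.next_fst _) _
  next_eq_self a ha := by
    by_cases h1 : a = d
    · rw [h1, Equiv.Perm.skip_apply_self]
    by_cases h2 : a = d.symm
    · rw [h2, skip_skip_apply_symm]
    have hH : ¬ H.Adj a.fst a.snd := by
      intro hH
      rw [deleteEdges_adj] at ha
      have : a.edge = d.edge := by
        by_contra hne
        exact ha ⟨hH, fun h => hne h⟩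
      rcases dart_edge_eq_iff a d |>.1 this with h | h
      exacts [h1 h, h2 h]
    have hna := R.next_eq_self a hH
    rw [Equiv.Perm.skip_apply_of_ne h1, Equiv.Perm.skip_apply_of_ne h2, hna]
    · rwa [hna]
    · rw [Equiv.Perm.skip_apply_of_ne h2 (by rwa [hna]), hna]; exact h1
  sameCycle a b ha hb hab := by
    have key : ∀ c : G.Dart, (H.deleteEdges {d.edge}).Adj c.fst c.snd →
        H.Adj c.fst c.snd ∧ c ≠ d ∧ c ≠ d.symm := by
      intro c hc
      rw [deleteEdges_adj] at hc
      have hne : c.edge ≠ d.edge := fun h => hc.2 h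
      exact ⟨hc.1, fun h => hne (by rw [h]), fun h => hne (by rw [h, Dart.edge_symm])⟩
    obtain ⟨ha, ha1, ha2⟩ := key a ha
    obtain ⟨hb, hb1, hb2⟩ := key b hb
    exact ((R.sameCycle a b ha hb hab).skip ha2 hb2).skip ha1 hb1

variable [Finite V] (R : SubRotation G H) (d : G.Dart)

theorem deleteEdge_face : (R.deleteEdge d).face =
    Equiv.swap d (R.next d) * (Equiv.swap d.symm (R.next d.symm) * R.face) := by
  have h : (R.deleteEdge d).next =
      Equiv.swap d (R.next d) * (Equiv.swap d.symm (R.next d.symm) * R.next) := by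
    rw [← skip_symm_apply R d]; rfl
  rw [face, face, h, mul_assoc, mul_assoc]

theorem numOrbits_deleteEdge_face :
    (R.face.numOrbits ≤ (R.deleteEdge d).face.numOrbits + (if R.next d = d then 1 else 0) +
      (if R.next d.symm = d.symm then 1 else 0)) ∧
    (R.face.SameCycle d d.symm →
      R.face.numOrbits + 2 ≤ (R.deleteEdge d).face.numOrbits +
        (if R.next d = d then 1 else 0) + (if R.next d.symm = d.symm then 1 else 0)) := by
  rw [deleteEdge_face]
  set ψ := Equiv.swap d.symm (R.next d.symm) * R.face with hψ
  have hψd : ψ d = d.symm := by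
    rw [hψ, Equiv.Perm.mul_apply, face_apply, Equiv.swap_apply_right]
  have hψd' : ψ d.symm = R.next d := by
    rw [hψ, Equiv.Perm.mul_apply, face_apply, Dart.symm_symm]
    exact Equiv.swap_apply_of_ne_of_ne (symm_ne_of_fst_eq (R.next_fst d))
      fun h => symm_ne_of_fst_eq rfl (R.next.injective h)
  have hA : ψ.numOrbits + 1 ≤ (Equiv.swap d (R.next d) * ψ).numOrbits +
      (if R.next d = d then 1 else 0) := by
    split_ifs with h
    · rw [h, Equiv.swap_self]; exact le_of_eq rfl
    · refine Equiv.Perm.numOrbits_lt_swap_mul (Ne.symm h) ⟨2, ?_⟩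
      rw [zpow_two, Equiv.Perm.mul_apply, hψd, hψd']
  have hB := (Equiv.Perm.numOrbits_le_swap_mul R.face d.symm (R.next d.symm)).2
  have hB' : R.face.SameCycle d d.symm →
      R.face.numOrbits + 1 ≤ ψ.numOrbits + (if R.next d.symm = d.symm then 1 else 0) := by
    intro hs
    split_ifs with h
    · rw [hψ, h, Equiv.swap_self]; exact le_of_eq rfl
    · exact Equiv.Perm.numOrbits_lt_swap_mul (Ne.symm h) (hs.symm.trans ⟨1, by simp [face_apply]⟩)
  rw [← hψ] at hB
  exact ⟨by omega, fun hs => by have := hB' hs; omega⟩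

theorem ncard_isolated_deleteEdge (hd : H.Adj d.fst d.snd) :
    {x : V | H.IsIsolated x}.ncard + (if R.next d = d then 1 else 0) +
      (if R.next d.symm = d.symm then 1 else 0) ≤
    {x : V | (H.deleteEdges {d.edge}).IsIsolated x}.ncard := by
  classical
  -- A vertex whose only remaining dart is deleted becomes isolated.
  have key : ∀ e : G.Dart, H.Adj e.fst e.snd → e.edge = d.edge → R.next e = e →
      (H.deleteEdges {d.edge}).IsIsolated e.fst := by
    intro e he hed hne w hw
    rw [deleteEdges_adj] at hw
    have hG : G.Adj e.fst w := R.le hw.1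
    obtain ⟨n, hn⟩ := R.sameCycle e ⟨(e.fst, w), hG⟩ he hw.1 rfl
    rw [Equiv.Perm.zpow_apply_eq_self_of_apply_eq_self hne] at hn
    apply hw.2
    have : s(e.fst, w) = e.edge := by rw [hn]; rfl
    rw [this, hed]; rfl
  have hsub : {x : V | H.IsIsolated x} ∪ ((if R.next d = d then {d.fst} else ∅) ∪
      (if R.next d.symm = d.symm then {d.snd} else ∅)) ⊆
      {x : V | (H.deleteEdges {d.edge}).IsIsolated x} := by
    rintro x (hx | hx | hx)
    · exact fun w hw => hx w (deleteEdges_adj.1 hw).1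
    · split_ifs at hx with h
      · rw [Set.mem_singleton_iff.1 hx]; exact key d hd rfl h
      · exact absurd hx (Set.notMem_empty _)
    · split_ifs at hx with h
      · rw [Set.mem_singleton_iff.1 hx]; exact key d.symm hd.symm (Dart.edge_symm d) h
      · exact absurd hx (Set.notMem_empty _)
  refine le_trans (le_of_eq ?_) (Set.ncard_le_ncard hsub (Set.toFinite _))
  rw [Set.ncard_union_eq _ (Set.toFinite _) (Set.toFinite _),
    Set.ncard_union_eq _ (Set.toFinite _) (Set.toFinite _), add_assoc]
  · split_ifs <;> simp
  · have := d.adj.ne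
    split_ifs <;> simp [this]
  · have h1 : d.fst ∉ {x : V | H.IsIsolated x} := fun h => h _ hd
    have h2 : d.snd ∉ {x : V | H.IsIsolated x} := fun h => h _ hd.symm
    split_ifs <;> simp_all

/-- The genus does not increase when an edge is deleted. -/
theorem excess_deleteEdge_le (hd : H.Adj d.fst d.snd) : (R.deleteEdge d).excess ≤ R.excess := by
  have h1 := R.numOrbits_deleteEdge_face d
  have h2 := R.ncard_isolated_deleteEdge d hd
  unfold excess
  by_cases h : (H.deleteEdges {d.edge}).Reachable d.fst d.snd
  · have h3 := card_connectedComponent_deleteEdge_of_reachable d h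
    have h4 := h1.1
    omega
  · have h3 := card_connectedComponent_deleteEdge (H := H) d
    have h4 := h1.2 (R.sameCycle_of_not_reachable d hd h)
    omega

end delete

end SubRotation

/-- Every spanning subgraph of a planar graph is planar. -/
theorem IsPlanar.exists_subRotation [Finite V] (hG : G.IsPlanar) (S : Set (Sym2 V)) :
    ∃ R : SubRotation G (G.deleteEdges S),
      R.excess ≤ (Nat.card V : ℤ) - (G.edgeSet.ncard : ℤ) := by
  classical
  induction S, S.toFinite using Set.Finite.induction_on with
  | empty =>
    obtain ⟨R, hR⟩ := hG
    rw [deleteEdges_empty]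
    refine ⟨⟨le_refl G, R.next, R.next_fst, fun d hd => absurd d.adj hd,
      fun d d' _ _ h => R.sameCycle_of_fst_eq d d' h⟩, ?_⟩
    have : R.numFaces = Equiv.Perm.numOrbits R.faceNext + {x : V | G.IsIsolated x}.ncard := rfl
    unfold RotationSystem.twiceGenus RotationSystem.eulerChar at hR
    rw [this] at hR
    unfold SubRotation.excess
    change 2 * (Nat.card G.ConnectedComponent : ℤ) - (Equiv.Perm.numOrbits R.faceNext : ℤ) - _ ≤ _
    push_cast at hR
    linarith
  | @insert e S _ _ ih =>
    obtain ⟨R, hR⟩ := ih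
    rw [Set.insert_eq, Set.union_comm, ← deleteEdges_deleteEdges]
    by_cases he : e ∈ (G.deleteEdges S).edgeSet
    · induction e using Sym2.ind with
      | _ x y =>
        have hxy : (G.deleteEdges S).Adj x y := he
        let d : G.Dart := ⟨(x, y), deleteEdges_le S hxy⟩
        exact ⟨R.deleteEdge d, (R.excess_deleteEdge_le d hxy).trans hR⟩
    · have : (G.deleteEdges S).deleteEdges {e} = G.deleteEdges S := by
        rw [deleteEdges_eq_self]
        exact Set.disjoint_singleton_right.2 he
      rw [this]
      exact ⟨R, hR⟩

end SimpleGraph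

/-! ### Facial walks of length three and five -/

section Discharging

open scoped Classical

namespace SimpleGraph

variable {V : Type u} {G H : SimpleGraph V} {Z : Finset V}

/-- The degree of `v` in the subgraph of `G` induced by `Z`, for `v ∈ Z`. -/
noncomputable def degIn (G : SimpleGraph V) (Z : Finset V) (v : V) : ℕ :=
  (Z.filter (G.Adj v)).card

/-- `G` satisfies the hypotheses on `4`-cycles and triangles, and none of the three configurations
that can be colored last occurs in the subgraph induced by `Z`: a vertex of degree at most two, two
adjacent vertices of degree three, and an induced path of three vertices of degrees three, four and
three. The last two occur only if an edge of the configuration lies in a triangle whose third vertex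
is outside `Z`. -/
structure IsCritical (G : SimpleGraph V) (Z : Finset V) : Prop where
  no_four_cycle : ∀ a b c d, G.Adj a b → G.Adj b c → G.Adj c d → G.Adj d a → a ≠ c → b = d
  triangle_eq : ∀ s t : Finset V, G.IsNClique 3 s → G.IsNClique 3 t →
    ∀ x ∈ s, ∀ y ∈ t, (x = y ∨ G.Adj x y) → s = t
  three_le_degIn : ∀ v ∈ Z, 3 ≤ G.degIn Z v
  edge : ∀ u ∈ Z, ∀ v ∈ Z, G.Adj u v → G.degIn Z u = 3 → G.degIn Z v = 3 →
    ∃ x ∉ Z, G.Adj x u ∧ G.Adj x v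
  path : ∀ u ∈ Z, ∀ v ∈ Z, ∀ w ∈ Z, G.Adj u v → G.Adj v w → u ≠ w → ¬ G.Adj u w →
    G.degIn Z u = 3 → G.degIn Z v = 4 → G.degIn Z w = 3 →
    (∃ x ∉ Z, G.Adj x u ∧ G.Adj x v) ∨ ∃ x ∉ Z, G.Adj x v ∧ G.Adj x w

theorem IsCritical.outer_triangle_far (hc : G.IsCritical Z) {a b c u v x : V} (ha : a ∈ Z)
    (hb : b ∈ Z) (hcZ : c ∈ Z) (habc : G.IsNClique 3 {a, b, c}) (huv : G.Adj u v) (hx : x ∉ Z)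
    (hxu : G.Adj x u) (hxv : G.Adj x v) {y : V} (hy : y ∈ ({a, b, c} : Finset V))
    (h : y = u ∨ G.Adj y u) : False := by
  have hs : G.IsNClique 3 {x, u, v} := is3Clique_triple_iff.2 ⟨hxu, hxv, huv⟩
  have := hc.triangle_eq _ _ habc hs y hy u (by simp) h
  have hx' : x ∈ ({a, b, c} : Finset V) := by rw [this]; simp
  simp only [Finset.mem_insert, Finset.mem_singleton] at hx'
  rcases hx' with rfl | rfl | rfl <;> exact hx ‹_›

namespace SubRotation

variable (R : SubRotation G H)

/-- The dart `d` of `H` lies on a facial walk of length three. -/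
def IsTriDart (d : G.Dart) : Prop := H.Adj d.fst d.snd ∧ R.face (R.face (R.face d)) = d

/-- The dart `d` of `H` lies on a facial walk of length five. -/
def IsPentaDart (d : G.Dart) : Prop :=
  H.Adj d.fst d.snd ∧ R.face (R.face (R.face (R.face (R.face d)))) = d

variable {R}

theorem face_snd_face_fst (d : G.Dart) : d.snd = (R.face d).fst := (R.face_fst d).symm

theorem IsTriDart.face {d : G.Dart} (hd : R.IsTriDart d) : R.IsTriDart (R.face d) :=
  ⟨R.adj_face hd.1, by rw [hd.2]⟩

theorem isTriDart_face_iff {d : G.Dart} : R.IsTriDart (R.face d) ↔ R.IsTriDart d := by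
  refine ⟨fun h => ?_, IsTriDart.face⟩
  have h3 : R.face (R.face (R.face d)) = d := R.face.injective h.2
  have := h.face.face
  rwa [h3] at this

theorem IsTriDart.snd_face_face {d : G.Dart} (hd : R.IsTriDart d) :
    (R.face (R.face d)).snd = d.fst := by
  rw [← R.face_fst, hd.2]

theorem IsTriDart.isNClique {d : G.Dart} (hd : R.IsTriDart d) :
    G.IsNClique 3 {d.fst, d.snd, (R.face d).snd} := by
  refine is3Clique_triple_iff.2 ⟨d.adj, ?_, ?_⟩
  · rw [← hd.snd_face_face, R.face_snd_face_fst (R.face d)]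
    exact (R.face (R.face d)).adj.symm
  · rw [R.face_snd_face_fst d]; exact (R.face d).adj

variable (hH : ∀ u v, H.Adj u v ↔ G.Adj u v ∧ u ∈ Z ∧ v ∈ Z) (hc : G.IsCritical Z)
include hH

theorem IsTriDart.mem {d : G.Dart} (hd : R.IsTriDart d) :
    d.fst ∈ Z ∧ d.snd ∈ Z ∧ (R.face d).snd ∈ Z :=
  ⟨((hH _ _).1 hd.1).2.1, ((hH _ _).1 hd.1).2.2, ((hH _ _).1 (R.adj_face hd.1)).2.2⟩

/-- A triangle contains at most one vertex of degree three. -/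
theorem IsTriDart.not_three_three (hc : G.IsCritical Z) {d : G.Dart} (hd : R.IsTriDart d) :
    ¬ (G.degIn Z d.fst = 3 ∧ G.degIn Z d.snd = 3) := by
  rintro ⟨h1, h2⟩
  obtain ⟨m1, m2, m3⟩ := hd.mem hH
  obtain ⟨x, hx, hxu, hxv⟩ := hc.edge _ m1 _ m2 d.adj h1 h2
  exact hc.outer_triangle_far m1 m2 m3 (hd.isNClique) d.adj hx hxu hxv (y := d.fst) (by simp)
    (.inl rfl)

variable [Fintype V]

theorem degIn_eq_card (v : V) (hv : v ∈ Z) :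
    G.degIn Z v = (Finset.univ.filter fun d : G.Dart => H.Adj d.fst d.snd ∧ d.fst = v).card := by
  unfold degIn
  refine (Finset.card_bij (fun d _ => d.snd) ?_ ?_ ?_).symm
  · rintro d hd
    simp only [Finset.mem_filter, Finset.mem_univ, true_and] at hd ⊢
    rw [hH] at hd
    exact ⟨hd.1.2.2, hd.2 ▸ hd.1.1⟩
  · rintro d hd e he hde
    simp only [Finset.mem_filter, Finset.mem_univ, true_and] at hd he
    exact Dart.ext _ _ (Prod.ext (hd.2.trans he.2.symm) hde)
  · rintro w hw
    simp only [Finset.mem_filter] at hw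
    exact ⟨⟨(v, w), hw.2⟩, by simp [hH, hw, hv], rfl⟩

include hc

theorem next_next_ne {d : G.Dart} (hd : H.Adj d.fst d.snd) : R.next (R.next d) ≠ d := by
  intro h
  have h3 := hc.three_le_degIn _ ((hH _ _).1 hd).2.1
  rw [degIn_eq_card hH _ ((hH _ _).1 hd).2.1] at h3
  have hsub : (Finset.univ.filter fun e : G.Dart => H.Adj e.fst e.snd ∧ e.fst = d.fst) ⊆
      {d, R.next d} := by
    intro e he
    simp only [Finset.mem_filter, Finset.mem_univ, true_and] at he
    obtain ⟨n, rfl⟩ := (R.sameCycle d e hd he.1 he.2.symm).exists_nat_pow_eq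
    clear he
    induction n with
    | zero => simp
    | succ n ih =>
      rw [pow_succ', Equiv.Perm.mul_apply]
      rcases Finset.mem_insert.1 ih with ih | ih
      · rw [ih]; simp
      · rw [Finset.mem_singleton.1 ih, h]; simp
  have := (Finset.card_le_card hsub).trans Finset.card_le_two
  omega

theorem next_ne {d : G.Dart} (hd : H.Adj d.fst d.snd) : R.next d ≠ d := fun h =>
  next_next_ne hH hc hd (by rw [h, h])

/-- Facial walks do not backtrack. -/
theorem snd_face_ne_fst {d : G.Dart} (hd : H.Adj d.fst d.snd) : (R.face d).snd ≠ d.fst := by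
  intro h
  apply next_ne (R := R) hH hc (d := d.symm) hd.symm
  exact Dart.ext _ _ (Prod.ext (R.face_fst d) h)

/-- A facial walk of `H` has length three, length five, or length at least six. -/
theorem minimalPeriod_face {d : G.Dart} (hd : H.Adj d.fst d.snd) :
    (R.IsTriDart d → 3 ≤ Function.minimalPeriod R.face d) ∧
    (¬ R.IsTriDart d → 5 ≤ Function.minimalPeriod R.face d) ∧
    (¬ R.IsTriDart d → ¬ R.IsPentaDart d → 6 ≤ Function.minimalPeriod R.face d) := by
  set n := Function.minimalPeriod R.face d with hn
  have hper : R.face^[n] d = d := Function.iterate_minimalPeriod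
  have h0 : n ≠ 0 := by
    have := Function.minimalPeriod_pos_of_mem_periodicPts
      (Function.Injective.mem_periodicPts R.face.injective d)
    omega
  have h1 : n ≠ 1 := by
    intro h
    rw [h] at hper
    have hf : R.face d = d := hper
    have := R.face_fst d
    rw [hf] at this
    exact d.adj.ne this
  have h2 : n ≠ 2 := by
    intro h
    rw [h] at hper
    have hf : R.face (R.face d) = d := hper
    have := R.face_fst (R.face d)
    rw [hf] at this
    exact snd_face_ne_fst hH hc hd this.symm
  have h4 : n ≠ 4 := by
    intro h
    rw [h] at hper
    have hf : R.face (R.face (R.face (R.face d))) = d := hper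
    have hd1 := R.adj_face hd
    have a2 := snd_face_ne_fst (R := R) hH hc hd
    have a3 := snd_face_ne_fst (R := R) hH hc hd1
    rw [R.face_snd_face_fst (R.face d)] at a2
    have e := R.face_fst (R.face (R.face (R.face d)))
    rw [hf] at e
    have b0 := d.adj
    have b1 := (R.face d).adj
    have b2 := (R.face (R.face d)).adj
    have b3 := (R.face (R.face (R.face d))).adj
    rw [R.face_snd_face_fst] at b0 b1 b2 a3
    rw [← e] at b3
    exact a3 (hc.no_four_cycle _ _ _ _ b0 b1 b2 b3 a2.symm).symm
  refine ⟨fun _ => by omega, fun ht => ?_, fun ht hp => ?_⟩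
  · have h3 : n ≠ 3 := fun h => ht ⟨hd, by rw [h] at hper; exact hper⟩
    omega
  · have h3 : n ≠ 3 := fun h => ht ⟨hd, by rw [h] at hper; exact hper⟩
    have h5 : n ≠ 5 := fun h => hp ⟨hd, by rw [h] at hper; exact hper⟩
    omega

/-- Each vertex lies on at most one facial triangle, and only once. -/
theorem IsTriDart.eq_of_fst_eq {d e : G.Dart} (hd : R.IsTriDart d) (he : R.IsTriDart e)
    (h : d.fst = e.fst) : d = e := by
  have hde := hc.triangle_eq _ _ (hd.isNClique) (he.isNClique) d.fst (by simp) e.fst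
    (by simp) (.inl h)
  have hes : e.snd ∈ ({d.fst, d.snd, (R.face d).snd} : Finset V) := by rw [hde]; simp
  have hes' : (R.face e).snd ∈ ({d.fst, d.snd, (R.face d).snd} : Finset V) := by rw [hde]; simp
  simp only [Finset.mem_insert, Finset.mem_singleton] at hes hes'
  have n1 := snd_face_ne_fst (R := R) hH hc he.1
  have n2 := e.adj.ne
  have n3 := (R.face e).adj.ne
  rw [R.face_fst] at n3
  rcases hes with h1 | h1 | h1
  · exact absurd (h.symm.trans h1.symm) n2
  · exact Dart.ext _ _ (Prod.ext h h1.symm)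
  · -- Otherwise the two facial triangles are traversed in opposite directions, and the vertex
    -- `(R.face d).snd` has degree two.
    exfalso
    have h2 : (R.face e).snd = d.snd := by
      rcases hes' with h2 | h2 | h2
      · exact absurd (h2.trans h) n1
      · exact h2
      · exact absurd (h1.trans h2.symm) n3
    have e1 : e.symm = R.face (R.face d) := by
      refine Dart.ext _ _ (Prod.ext ?_ ?_)
      · change e.snd = _; rw [R.face_fst, h1]
      · change e.fst = _; rw [hd.snd_face_face, h]
    have e2 : R.face e = (R.face d).symm := by
      refine Dart.ext _ _ (Prod.ext ?_ ?_)
      · change _ = (R.face d).snd; rw [R.face_fst, h1]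
      · change _ = (R.face d).fst; rw [R.face_fst, h2]
    apply next_next_ne (R := R) hH hc hd.face.face.1
    rw [← e1]
    change R.next (R.face e) = _
    rw [e2, e1]
    rfl

/-- The two sides of an edge are not both facial triangles. -/
theorem IsTriDart.not_symm {d : G.Dart} (hd : R.IsTriDart d) : ¬ R.IsTriDart d.symm := by
  intro hs
  have h1 := hs.face.eq_of_fst_eq hH hc hd (by rw [R.face_fst]; rfl)
  rw [face_apply, Dart.symm_symm] at h1
  exact next_ne hH hc hd.1 h1

/-- Two consecutive edges of a facial walk are not both opposite to facial triangles. -/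
theorem IsTriDart.not_symm_face {d : G.Dart} (hd : R.IsTriDart d.symm) :
    ¬ R.IsTriDart (R.face d).symm := by
  intro hs
  have h1 := hs.face.eq_of_fst_eq hH hc hd (by
    rw [R.face_fst]; change (R.face d).fst = d.snd; rw [R.face_fst])
  rw [face_apply, Dart.symm_symm, face_apply] at h1
  exact next_next_ne hH hc hd.1 h1

end SubRotation

end SimpleGraph

end Discharging

/-! ### The charge sent by the faces -/

section Discharging

open scoped Classical

namespace SimpleGraph

variable {V : Type u} {G H : SimpleGraph V} {Z : Finset V}

namespace SubRotation

/-- The vertex `v` lies on a facial triangle. -/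
def OnTriangle (R : SubRotation G H) (v : V) : Prop := ∃ d, R.IsTriDart d ∧ d.fst = v

/-- The sum of the degrees of the vertices of the facial triangle through `d`. -/
noncomputable def triangleDegree (R : SubRotation G H) (Z : Finset V) (d : G.Dart) : ℕ :=
  G.degIn Z d.fst + G.degIn Z d.snd + G.degIn Z (R.face d).snd

/-- The charge that the facial triangle through `d` and its vertices lack. -/
noncomputable def need (R : SubRotation G H) (Z : Finset V) (d : G.Dart) : ℚ :=
  max 0 (13 - (R.triangleDegree Z d : ℚ))

/-- The charge that the face of `d` sends to the origin of `d`: one third to each vertex of degree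
three that is not on a facial triangle. -/
noncomputable def vertexPay (R : SubRotation G H) (Z : Finset V) (d : G.Dart) : ℚ :=
  if G.degIn Z d.fst = 3 ∧ ¬ R.OnTriangle d.fst then 1 / 3 else 0

/-- Half of the charge that the face of `d` sends across the edge of `d` to a facial triangle. -/
noncomputable def edgePay (R : SubRotation G H) (Z : Finset V) (d : G.Dart) : ℚ :=
  if R.IsTriDart d.symm then R.need Z d.symm / 6 else 0

/-- The charge that the face of `d` sends away at the origin of `d`. What crosses an edge is divided
equally between the two ends of this edge. -/
noncomputable def pay (R : SubRotation G H) (Z : Finset V) (d : G.Dart) : ℚ :=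
  R.vertexPay Z d + R.edgePay Z d + R.edgePay Z (R.face.symm d)

variable {R : SubRotation G H}

variable (hH : ∀ u v, H.Adj u v ↔ G.Adj u v ∧ u ∈ Z ∧ v ∈ Z) (hc : G.IsCritical Z)
include hH hc

theorem IsTriDart.eleven_le {d : G.Dart} (hd : R.IsTriDart d) : 11 ≤ R.triangleDegree Z d := by
  obtain ⟨m1, m2, m3⟩ := hd.mem hH
  have a1 := hc.three_le_degIn _ m1
  have a2 := hc.three_le_degIn _ m2
  have a3 := hc.three_le_degIn _ m3
  have b1 := hd.not_three_three hH hc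
  have b2 := hd.face.not_three_three hH hc
  have b3 := hd.face.face.not_three_three hH hc
  rw [hd.snd_face_face] at b3
  rw [R.face_fst] at b2 b3
  unfold triangleDegree
  omega

theorem IsTriDart.need_le {d : G.Dart} (hd : R.IsTriDart d) : R.need Z d ≤ 2 := by
  have : (11 : ℚ) ≤ R.triangleDegree Z d := by exact_mod_cast hd.eleven_le hH hc
  exact max_le (by norm_num) (by linarith)

theorem edgePay_le (d : G.Dart) : R.edgePay Z d ≤ 1 / 3 := by
  unfold edgePay
  split_ifs with h
  · linarith [h.need_le hH hc]
  · norm_num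

variable [Fintype V]

theorem IsTriDart.pay_eq_zero {d : G.Dart} (hd : R.IsTriDart d) : R.pay Z d = 0 := by
  have h1 : ¬ R.IsTriDart (R.face.symm d).symm := by
    have : R.IsTriDart (R.face.symm d) := isTriDart_face_iff.1 (by rwa [Equiv.apply_symm_apply])
    exact this.not_symm hH hc
  have h2 : R.OnTriangle d.fst := ⟨d, hd, rfl⟩
  simp [pay, vertexPay, edgePay, h1, h2, hd.not_symm hH hc]

theorem pay_le {d : G.Dart} : R.pay Z d ≤ 1 / 3 := by
  have e := edgePay_le (R := R) hH hc d
  have e' := edgePay_le (R := R) hH hc (R.face.symm d)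
  set c := R.face.symm d with hcd
  have hd : R.face c = d := by rw [hcd, Equiv.apply_symm_apply]
  rw [← hd] at e ⊢
  unfold pay
  rw [Equiv.symm_apply_apply]
  by_cases h1 : R.IsTriDart (R.face c).symm
  · have h2 : ¬ R.IsTriDart c.symm := fun h => h.not_symm_face hH hc h1
    have h3 : R.OnTriangle (R.face c).fst := ⟨_, h1.face, by rw [R.face_fst]; rfl⟩
    have v0 : R.vertexPay Z (R.face c) = 0 := by simp [vertexPay, h3]
    have e0 : R.edgePay Z c = 0 := by simp [edgePay, h2]
    linarith
  · have e0 : R.edgePay Z (R.face c) = 0 := by simp [edgePay, h1]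
    by_cases h2 : R.IsTriDart c.symm
    · have h3 : R.OnTriangle (R.face c).fst := ⟨_, h2, by rw [R.face_fst]; rfl⟩
      have v0 : R.vertexPay Z (R.face c) = 0 := by simp [vertexPay, h3]
      linarith
    · have e1 : R.edgePay Z c = 0 := by simp [edgePay, h2]
      have : R.vertexPay Z (R.face c) ≤ 1 / 3 := by unfold vertexPay; split_ifs <;> norm_num
      linarith

/-- A face of length five that shares no edge with a facial triangle has at most three vertices of
degree three, because otherwise three of them are consecutive. -/
theorem penta_pay_of_not_tri {d₀ d₁ d₂ d₃ d₄ : G.Dart} (hd : H.Adj d₀.fst d₀.snd)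
    (h₀ : R.face d₀ = d₁) (h₁ : R.face d₁ = d₂) (h₂ : R.face d₂ = d₃) (h₃ : R.face d₃ = d₄)
    (h₄ : R.face d₄ = d₀) :
    R.vertexPay Z d₀ + R.vertexPay Z d₁ + R.vertexPay Z d₂ + R.vertexPay Z d₃ +
      R.vertexPay Z d₄ ≤ 1 := by
  have key : ∀ a b c : G.Dart, H.Adj a.fst a.snd → R.face a = b → R.face b = c →
      ¬ (G.degIn Z a.fst = 3 ∧ G.degIn Z b.fst = 3 ∧ G.degIn Z c.fst = 3) := by
    rintro a b c ha rfl rfl ⟨k1, k2, k3⟩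
    have nb := snd_face_ne_fst (R := R) hH hc ha
    have hb := R.adj_face ha
    have hc' := R.adj_face hb
    rw [hH] at ha hb hc'
    rw [R.face_fst] at k2 k3
    obtain ⟨x, hx, hx1, hx2⟩ := hc.edge _ ha.2.1 _ ha.2.2 ha.1 k1 k2
    obtain ⟨y, hy, hy1, hy2⟩ := hc.edge _ ha.2.2 _ hb.2.2
      (by have := hb.1; rwa [R.face_fst] at this) k2 k3
    have s1 : G.IsNClique 3 {x, a.fst, a.snd} := is3Clique_triple_iff.2 ⟨hx1, hx2, ha.1⟩
    have s2 : G.IsNClique 3 {y, a.snd, (R.face a).snd} := is3Clique_triple_iff.2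
      ⟨hy1, hy2, by have := hb.1; rwa [R.face_fst] at this⟩
    have hst := hc.triangle_eq _ _ s1 s2 a.snd (by simp) a.snd (by simp) (.inl rfl)
    have hm : (R.face a).snd ∈ ({x, a.fst, a.snd} : Finset V) := by rw [hst]; simp
    simp only [Finset.mem_insert, Finset.mem_singleton] at hm
    rcases hm with hm | hm | hm
    · exact hx (hm ▸ hb.2.2)
    · exact nb hm
    · have := (R.face a).adj.ne
      rw [R.face_fst] at this
      exact this hm.symm
  have a₀ := hd
  have a₁ := R.adj_face a₀
  rw [h₀] at a₁
  have a₂ := R.adj_face a₁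
  rw [h₁] at a₂
  have a₃ := R.adj_face a₂
  rw [h₂] at a₃
  have a₄ := R.adj_face a₃
  rw [h₃] at a₄
  have k0 := key _ _ _ a₀ h₀ h₁
  have k1 := key _ _ _ a₁ h₁ h₂
  have k2 := key _ _ _ a₂ h₂ h₃
  have k3 := key _ _ _ a₃ h₃ h₄
  have k4 := key _ _ _ a₄ h₄ h₀
  have b : ∀ e, R.vertexPay Z e ≤ 1 / 3 := fun e => by
    unfold vertexPay; split_ifs <;> norm_num
  have z : ∀ e : G.Dart, G.degIn Z e.fst ≠ 3 → R.vertexPay Z e = 0 := fun e he => by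
    simp [vertexPay, he]
  have y : ∀ e : G.Dart, G.degIn Z e.fst = 3 ∨ R.vertexPay Z e = 0 := fun e =>
    (em _).imp id (z e)
  have := b d₀; have := b d₁; have := b d₂; have := b d₃; have := b d₄
  -- Two of the five vertices do not have degree three.
  rcases y d₀ with q0 | q0 <;> rcases y d₁ with q1 | q1 <;> rcases y d₂ with q2 | q2 <;>
  rcases y d₃ with q3 | q3 <;> rcases y d₄ with q4 | q4 <;>
  first
  | linarith
  | (exfalso; tauto)

/-- A face of length five that shares an edge with a facial triangle shares only this edge, and the
vertices of degree three among the other three vertices of the face are too few for the face to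
become negative. -/
theorem penta_pay_of_tri {d₀ d₁ d₂ d₃ d₄ : G.Dart} (hd : H.Adj d₀.fst d₀.snd)
    (h₀ : R.face d₀ = d₁) (h₁ : R.face d₁ = d₂) (h₂ : R.face d₂ = d₃) (h₃ : R.face d₃ = d₄)
    (h₄ : R.face d₄ = d₀) (hT : R.IsTriDart d₀.symm) :
    (R.vertexPay Z d₀ + R.vertexPay Z d₁ + R.vertexPay Z d₂ + R.vertexPay Z d₃ +
      R.vertexPay Z d₄) + 2 * (R.edgePay Z d₀ + R.edgePay Z d₁ + R.edgePay Z d₂ +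
      R.edgePay Z d₃ + R.edgePay Z d₄) ≤ 1 := by
  have a₀ := hd
  have a₁ := R.adj_face a₀
  rw [h₀] at a₁
  have a₂ := R.adj_face a₁
  rw [h₁] at a₂
  have a₃ := R.adj_face a₂
  rw [h₂] at a₃
  have a₄ := R.adj_face a₃
  rw [h₃] at a₄
  have s₀ : d₀.snd = d₁.fst := by rw [← h₀, R.face_fst]
  have s₁ : d₁.snd = d₂.fst := by rw [← h₁, R.face_fst]
  have s₂ : d₂.snd = d₃.fst := by rw [← h₂, R.face_fst]
  have s₃ : d₃.snd = d₄.fst := by rw [← h₃, R.face_fst]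
  have s₄ : d₄.snd = d₀.fst := by rw [← h₄, R.face_fst]
  have n₀ := snd_face_ne_fst (R := R) hH hc a₀
  have n₁ := snd_face_ne_fst (R := R) hH hc a₁
  have n₂ := snd_face_ne_fst (R := R) hH hc a₂
  have n₃ := snd_face_ne_fst (R := R) hH hc a₃
  have n₄ := snd_face_ne_fst (R := R) hH hc a₄
  rw [h₀, s₁] at n₀
  rw [h₁, s₂] at n₁
  rw [h₂, s₃] at n₂
  rw [h₃, s₄] at n₃
  rw [h₄, s₀] at n₄
  rw [hH, s₀] at a₀
  rw [hH, s₁] at a₁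
  rw [hH, s₂] at a₂
  rw [hH, s₃] at a₃
  rw [hH, s₄] at a₄
  obtain ⟨c₀, m₀, m₁⟩ := a₀
  obtain ⟨c₁, -, m₂⟩ := a₁
  obtain ⟨c₂, -, m₃⟩ := a₂
  obtain ⟨c₃, -, m₄⟩ := a₃
  obtain ⟨c₄, -, -⟩ := a₄
  set w := (R.face d₀.symm).snd with hw
  have hmem := hT.mem hH
  have hclq := hT.isNClique
  have hdeg : R.triangleDegree Z d₀.symm = G.degIn Z d₁.fst + G.degIn Z d₀.fst + G.degIn Z w := by
    rw [← s₀]; rfl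
  change d₀.snd ∈ Z ∧ d₀.fst ∈ Z ∧ w ∈ Z at hmem
  change G.IsNClique 3 {d₀.snd, d₀.fst, w} at hclq
  rw [s₀] at hmem hclq
  obtain ⟨-, -, mw⟩ := hmem
  have hclq' := is3Clique_triple_iff.1 hclq
  have p₀ : R.vertexPay Z d₀ = 0 := by
    have : R.OnTriangle d₀.fst := ⟨_, hT.face, by rw [R.face_fst]; rfl⟩
    simp [vertexPay, this]
  have p₁ : R.vertexPay Z d₁ = 0 := by
    have : R.OnTriangle d₁.fst := ⟨_, hT, by rw [← s₀]; rfl⟩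
    simp [vertexPay, this]
  have f₁ : R.edgePay Z d₁ = 0 := by
    have : ¬ R.IsTriDart d₁.symm := by rw [← h₀]; exact hT.not_symm_face hH hc
    simp [edgePay, this]
  have f₄ : R.edgePay Z d₄ = 0 := by
    have : ¬ R.IsTriDart d₄.symm := fun h => h.not_symm_face hH hc (by rwa [h₄])
    simp [edgePay, this]
  have f₂ : R.edgePay Z d₂ = 0 := by
    have : ¬ R.IsTriDart d₂.symm := by
      intro h
      have hq := h.isNClique
      change G.IsNClique 3 {d₂.snd, d₂.fst, (R.face d₂.symm).snd} at hq
      have he := hc.triangle_eq _ _ hclq hq d₁.fst (by simp) d₂.fst (by simp) (.inr c₁)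
      have e2 : d₂.fst ∈ ({d₁.fst, d₀.fst, w} : Finset V) := by rw [he]; simp
      have e3 : d₃.fst ∈ ({d₁.fst, d₀.fst, w} : Finset V) := by rw [he, ← s₂]; simp
      simp only [Finset.mem_insert, Finset.mem_singleton] at e2 e3
      have e2' : d₂.fst = w := by
        rcases e2 with e2 | e2 | e2
        exacts [absurd e2 c₁.ne', absurd e2 n₀, e2]
      rcases e3 with e3 | e3 | e3
      exacts [n₁ e3, n₃ e3.symm, c₂.ne' (e3.trans e2'.symm)]
    simp [edgePay, this]
  have f₃ : R.edgePay Z d₃ = 0 := by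
    have : ¬ R.IsTriDart d₃.symm := by
      intro h
      have hq := h.isNClique
      change G.IsNClique 3 {d₃.snd, d₃.fst, (R.face d₃.symm).snd} at hq
      have he := hc.triangle_eq _ _ hclq hq d₀.fst (by simp) d₃.snd (by simp)
        (.inr (by rw [s₃]; exact c₄.symm))
      have e3 : d₃.fst ∈ ({d₁.fst, d₀.fst, w} : Finset V) := by rw [he]; simp
      have e4 : d₄.fst ∈ ({d₁.fst, d₀.fst, w} : Finset V) := by rw [he, ← s₃]; simp
      simp only [Finset.mem_insert, Finset.mem_singleton] at e3 e4
      have e3' : d₃.fst = w := by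
        rcases e3 with e3 | e3 | e3
        exacts [absurd e3 n₁, absurd e3.symm n₃, e3]
      rcases e4 with e4 | e4 | e4
      exacts [n₄ e4.symm, c₄.ne e4, c₃.ne' (e4.trans e3'.symm)]
    simp [edgePay, this]
  have f₀ : R.edgePay Z d₀ = R.need Z d₀.symm / 6 := by simp [edgePay, hT]
  have hneed := hT.need_le hH hc
  have far : ∀ u v x : V, G.Adj u v → x ∉ Z → G.Adj x u → G.Adj x v → ∀ y,
      (y = d₁.fst ∨ y = d₀.fst ∨ y = w) → (y = u ∨ G.Adj y u) → False :=
    fun u v x huv hx hxu hxv y hy h =>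
      hc.outer_triangle_far m₁ m₀ mw hclq huv hx hxu hxv (y := y) (by simpa using hy) h
  have q23 : ¬ (G.degIn Z d₂.fst = 3 ∧ G.degIn Z d₃.fst = 3) := by
    rintro ⟨k2, k3⟩
    obtain ⟨x, hx, hx1, hx2⟩ := hc.edge _ m₂ _ m₃ c₂ k2 k3
    exact far _ _ x c₂ hx hx1 hx2 d₁.fst (.inl rfl) (.inr c₁)
  have q34 : ¬ (G.degIn Z d₃.fst = 3 ∧ G.degIn Z d₄.fst = 3) := by
    rintro ⟨k3, k4⟩
    obtain ⟨x, hx, hx1, hx2⟩ := hc.edge _ m₃ _ m₄ c₃ k3 k4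
    exact far _ _ x c₃.symm hx hx2 hx1 d₀.fst (.inr (.inl rfl)) (.inr c₄.symm)
  -- If both neighbors of the shared edge on the face have degree three, then the triangle does not
  -- have the degrees three, four and four.
  have q24 : G.degIn Z d₂.fst = 3 → G.degIn Z d₄.fst = 3 → R.need Z d₀.symm ≤ 1 := by
    intro k2 k4
    have h12 : 12 ≤ R.triangleDegree Z d₀.symm := by
      by_contra hlt
      have b0 := hc.three_le_degIn _ m₀
      have b1 := hc.three_le_degIn _ m₁
      have bw := hc.three_le_degIn _ mw
      have t1 : G.degIn Z d₀.fst ≠ 3 := by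
        intro k0
        obtain ⟨x, hx, hx1, hx2⟩ := hc.edge _ m₄ _ m₀ c₄ k4 k0
        exact far _ _ x c₄.symm hx hx2 hx1 d₀.fst (.inr (.inl rfl)) (.inl rfl)
      have t2 : G.degIn Z d₁.fst ≠ 3 := by
        intro k1
        obtain ⟨x, hx, hx1, hx2⟩ := hc.edge _ m₁ _ m₂ c₁ k1 k2
        exact far _ _ x c₁ hx hx1 hx2 d₁.fst (.inl rfl) (.inl rfl)
      have kw : G.degIn Z w = 3 := by omega
      have k0 : G.degIn Z d₀.fst = 4 := by omega
      by_cases h4w : d₄.fst = w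
      · -- The vertex `d₄.fst` is the third vertex of the triangle, which closes a four-cycle.
        have := hc.no_four_cycle d₁.fst d₂.fst d₃.fst d₄.fst c₁ c₂ c₃
          (by rw [h4w]; exact hclq'.2.1.symm) n₁.symm
        exact n₂ this.symm
      · have hnadj : ¬ G.Adj d₄.fst w := by
          intro hadj
          have hq : G.IsNClique 3 {d₄.fst, d₀.fst, w} :=
            is3Clique_triple_iff.2 ⟨c₄, hadj, hclq'.2.2⟩
          have he := hc.triangle_eq _ _ hclq hq d₀.fst (by simp) d₀.fst (by simp) (.inl rfl)
          have e4 : d₄.fst ∈ ({d₁.fst, d₀.fst, w} : Finset V) := by rw [he]; simp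
          simp only [Finset.mem_insert, Finset.mem_singleton] at e4
          rcases e4 with e4 | e4 | e4
          exacts [n₄ e4.symm, c₄.ne e4, h4w e4]
        rcases hc.path _ m₄ _ m₀ _ mw c₄ hclq'.2.2 h4w hnadj k4 k0 kw with
          ⟨x, hx, hx1, hx2⟩ | ⟨x, hx, hx1, hx2⟩
        · exact far _ _ x c₄.symm hx hx2 hx1 d₀.fst (.inr (.inl rfl)) (.inl rfl)
        · exact far _ _ x hclq'.2.2 hx hx1 hx2 d₀.fst (.inr (.inl rfl)) (.inl rfl)
    have : (12 : ℚ) ≤ R.triangleDegree Z d₀.symm := by exact_mod_cast h12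
    exact max_le (by norm_num) (by linarith)
  have b : ∀ e, R.vertexPay Z e ≤ 1 / 3 := fun e => by
    unfold vertexPay; split_ifs <;> norm_num
  have z : ∀ e : G.Dart, G.degIn Z e.fst ≠ 3 → R.vertexPay Z e = 0 := fun e he => by
    simp [vertexPay, he]
  have := b d₂; have := b d₃; have := b d₄
  rw [p₀, p₁, f₀, f₁, f₂, f₃, f₄]
  by_cases r3 : G.degIn Z d₃.fst = 3
  · have := z d₂ fun h => q23 ⟨h, r3⟩
    have := z d₄ fun h => q34 ⟨r3, h⟩
    linarith
  · have := z d₃ r3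
    by_cases r2 : G.degIn Z d₂.fst = 3
    · by_cases r4 : G.degIn Z d₄.fst = 3
      · linarith [q24 r2 r4]
      · linarith [z d₄ r4]
    · linarith [z d₂ r2]

theorem penta_pay {d : G.Dart} (hd : R.IsPentaDart d) :
    R.pay Z d + R.pay Z (R.face d) + R.pay Z (R.face (R.face d)) +
      R.pay Z (R.face (R.face (R.face d))) + R.pay Z (R.face (R.face (R.face (R.face d)))) ≤ 1 := by
  obtain ⟨hd, h₄⟩ := hd
  generalize h₀ : R.face d = d₁ at *
  generalize h₁ : R.face d₁ = d₂ at *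
  generalize h₂ : R.face d₂ = d₃ at *
  generalize h₃ : R.face d₃ = d₄ at *
  have hsum : R.pay Z d + R.pay Z d₁ + R.pay Z d₂ + R.pay Z d₃ + R.pay Z d₄ =
      (R.vertexPay Z d + R.vertexPay Z d₁ + R.vertexPay Z d₂ + R.vertexPay Z d₃ +
      R.vertexPay Z d₄) + 2 * (R.edgePay Z d + R.edgePay Z d₁ + R.edgePay Z d₂ +
      R.edgePay Z d₃ + R.edgePay Z d₄) := by
    unfold pay
    rw [R.face.symm_apply_eq.2 h₄.symm, R.face.symm_apply_eq.2 h₀.symm,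
      R.face.symm_apply_eq.2 h₁.symm, R.face.symm_apply_eq.2 h₂.symm,
      R.face.symm_apply_eq.2 h₃.symm]
    ring
  rw [hsum]
  have a₁ := R.adj_face hd
  rw [h₀] at a₁
  have a₂ := R.adj_face a₁
  rw [h₁] at a₂
  have a₃ := R.adj_face a₂
  rw [h₂] at a₃
  have a₄ := R.adj_face a₃
  rw [h₃] at a₄
  by_cases t₀ : R.IsTriDart d.symm
  · exact penta_pay_of_tri hH hc hd h₀ h₁ h₂ h₃ h₄ t₀
  by_cases t₁ : R.IsTriDart d₁.symm
  · linarith [penta_pay_of_tri hH hc a₁ h₁ h₂ h₃ h₄ h₀ t₁]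
  by_cases t₂ : R.IsTriDart d₂.symm
  · linarith [penta_pay_of_tri hH hc a₂ h₂ h₃ h₄ h₀ h₁ t₂]
  by_cases t₃ : R.IsTriDart d₃.symm
  · linarith [penta_pay_of_tri hH hc a₃ h₃ h₄ h₀ h₁ h₂ t₃]
  by_cases t₄ : R.IsTriDart d₄.symm
  · linarith [penta_pay_of_tri hH hc a₄ h₄ h₀ h₁ h₂ h₃ t₄]
  have := penta_pay_of_not_tri hH hc hd h₀ h₁ h₂ h₃ h₄
  simp only [edgePay, t₀, t₁, t₂, t₃, t₄, if_false]
  linarith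

end SubRotation

end SimpleGraph

end Discharging

/-! ### Euler's inequality and the final count -/

section Discharging

open scoped Classical

namespace SimpleGraph

variable {V : Type u} [Fintype V] {G H : SimpleGraph V} {Z : Finset V}

namespace SubRotation

/-- An upper bound for the reciprocal of the length of the facial walk through `d`. -/
noncomputable def faceWeight (R : SubRotation G H) (d : G.Dart) : ℚ :=
  if R.IsTriDart d then 1 / 3 else if R.IsPentaDart d then 1 / 5 else 1 / 6

variable {R : SubRotation G H}
variable (hH : ∀ u v, H.Adj u v ↔ G.Adj u v ∧ u ∈ Z ∧ v ∈ Z)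
include hH

/-- The vertices outside `Z` are isolated in `H`, hence form components of their own. -/
theorem card_compl_lt_card_connectedComponent (hZ : Z.Nonempty) :
    Zᶜ.card + 1 ≤ Nat.card H.ConnectedComponent := by
  obtain ⟨z, hz⟩ := hZ
  have key : ∀ v ∉ Z, ∀ w, H.Reachable v w → v = w := by
    rintro v hv w ⟨p⟩
    cases p with
    | nil => rfl
    | cons h p => exact absurd ((hH _ _).1 h).2.1 hv
  let f : Option {v // v ∉ Z} → H.ConnectedComponent := fun o =>
    o.elim (H.connectedComponentMk z) fun v => H.connectedComponentMk v.1
  have hf : Function.Injective f := by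
    rintro (_ | v) (_ | w) h
    · rfl
    · have := key _ w.2 _ (ConnectedComponent.exact h).symm
      exact absurd (this ▸ hz) w.2
    · have := key _ v.2 _ (ConnectedComponent.exact h)
      exact absurd (this ▸ hz) v.2
    · rw [Subtype.ext (key _ v.2 _ (ConnectedComponent.exact h))]
  have := Nat.card_le_card_of_injective f hf
  rwa [Finite.card_option, Nat.card_eq_fintype_card, Fintype.card_subtype,
    show Finset.univ.filter (· ∉ Z) = Zᶜ by ext; simp] at this

theorem sum_darts_eq (f : G.Dart → ℚ) : ∑ d : G.Dart with H.Adj d.fst d.snd, f d =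
    ∑ v ∈ Z, ∑ d : G.Dart with H.Adj d.fst d.snd ∧ d.fst = v, f d := by
  rw [← Finset.sum_fiberwise_of_maps_to (t := Z) (g := fun d : G.Dart => d.fst) fun d hd =>
    ((hH _ _).1 (Finset.mem_filter.1 hd).2).2.1]
  simp only [Finset.filter_filter]

/-- The charge sent across edges reaches the facial triangles. -/
theorem sum_pay_eq : ∑ d : G.Dart with H.Adj d.fst d.snd, R.pay Z d =
    ∑ v ∈ Z, (if G.degIn Z v = 3 ∧ ¬ R.OnTriangle v then 1 else 0) +
      ∑ d : G.Dart with R.IsTriDart d, R.need Z d / 3 := by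
  have hshift : ∑ d : G.Dart with H.Adj d.fst d.snd, R.edgePay Z (R.face.symm d) =
      ∑ d : G.Dart with H.Adj d.fst d.snd, R.edgePay Z d := by
    refine (Finset.sum_equiv R.face (fun d => ?_) fun d _ => ?_).symm
    · simp only [Finset.mem_filter, Finset.mem_univ, true_and]
      refine ⟨R.adj_face, fun h => ?_⟩
      by_contra hn
      have h1 := R.next_eq_self d.symm fun h => hn h.symm
      rw [face_apply, h1] at h
      exact hn h.symm
    · rw [Equiv.symm_apply_apply]
  have hedge : ∑ d : G.Dart with H.Adj d.fst d.snd, R.edgePay Z d =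
      ∑ d : G.Dart with R.IsTriDart d, R.need Z d / 6 := by
    unfold edgePay
    rw [← Finset.sum_filter, Finset.filter_filter]
    refine Finset.sum_equiv (Function.Involutive.toPerm Dart.symm Dart.symm_involutive)
      (fun d => ?_) fun _ _ => rfl
    simp only [Finset.mem_filter, Finset.mem_univ, true_and]
    exact ⟨fun h => h.2, fun h => ⟨h.1.symm, h⟩⟩
  have hvertex : ∑ d : G.Dart with H.Adj d.fst d.snd, R.vertexPay Z d =
      ∑ v ∈ Z, (if G.degIn Z v = 3 ∧ ¬ R.OnTriangle v then 1 else 0) := by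
    rw [sum_darts_eq hH]
    refine Finset.sum_congr rfl fun v hv => ?_
    rw [Finset.sum_congr rfl (g := fun _ =>
      if G.degIn Z v = 3 ∧ ¬ R.OnTriangle v then (1 / 3 : ℚ) else 0) fun d hd => by
        rw [vertexPay, (Finset.mem_filter.1 hd).2.2], Finset.sum_const, ← degIn_eq_card hH v hv]
    split_ifs with h
    · rw [h.1]; norm_num
    · simp
  unfold pay
  rw [Finset.sum_add_distrib, Finset.sum_add_distrib, hshift, hedge, hvertex, add_assoc,
    ← Finset.sum_add_distrib]
  congr 1
  exact Finset.sum_congr rfl fun d _ => by ring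

variable (hc : G.IsCritical Z)
include hc

theorem ncard_isolated_le : {x : V | H.IsIsolated x}.ncard ≤ Zᶜ.card := by
  rw [← Set.ncard_coe_finset]
  refine Set.ncard_le_ncard (fun x hx => ?_) (Set.toFinite _)
  simp only [Finset.coe_compl, Set.mem_compl_iff, Finset.mem_coe]
  intro hxZ
  have h3 := hc.three_le_degIn x hxZ
  have : 0 < (Z.filter (G.Adj x)).card := by unfold degIn at h3; omega
  obtain ⟨y, hy⟩ := Finset.card_pos.1 this
  rw [Finset.mem_filter] at hy
  exact hx y ((hH _ _).2 ⟨hy.2, hxZ, hy.1⟩)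

/-- Each facial walk of `H` has length three, five, or at least six, and each deleted edge forms a
cycle of length two. -/
theorem numOrbits_face_le : (R.face.numOrbits : ℚ) ≤
    ∑ d : G.Dart, if H.Adj d.fst d.snd then R.faceWeight d else 1 / 2 := by
  rw [Equiv.Perm.numOrbits_eq_sum]
  refine Finset.sum_le_sum fun d _ => ?_
  have inv : ∀ k : ℕ, 0 < k → k ≤ Function.minimalPeriod R.face d →
      1 / (Function.minimalPeriod R.face d : ℚ) ≤ 1 / (k : ℚ) := fun k hk h =>
    one_div_le_one_div_of_le (by exact_mod_cast hk) (by exact_mod_cast h)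
  split_ifs with hd
  · obtain ⟨h3, h5, h6⟩ := minimalPeriod_face (R := R) hH hc hd
    unfold faceWeight
    split_ifs with ht hp
    · exact_mod_cast inv 3 (by norm_num) (h3 ht)
    · exact_mod_cast inv 5 (by norm_num) (h5 ht)
    · exact_mod_cast inv 6 (by norm_num) (h6 ht hp)
  · refine mod_cast inv 2 (by norm_num) ?_
    have h0 := Function.minimalPeriod_pos_of_mem_periodicPts
      (Function.Injective.mem_periodicPts R.face.injective d)
    have h1 : Function.minimalPeriod R.face d ≠ 1 := by
      intro h
      have hf : R.face d = d := by
        have := Function.iterate_minimalPeriod (f := R.face) (x := d)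
        rwa [h] at this
      have := R.face_fst d
      rw [hf] at this
      exact d.adj.ne this
    omega

/-- Euler's inequality for `H`. -/
theorem two_add_sum_le (hZ : Z.Nonempty)
    (hR : R.excess ≤ (Nat.card V : ℤ) - (G.edgeSet.ncard : ℤ)) :
    2 + ∑ d : G.Dart with H.Adj d.fst d.snd, (1 / 2 - R.faceWeight d) ≤ (Z.card : ℚ) := by
  have hC := card_compl_lt_card_connectedComponent hH hZ
  have hI := ncard_isolated_le hH hc
  have hO := numOrbits_face_le (R := R) hH hc
  have hZc := Finset.card_compl Z
  have hZle := Finset.card_le_univ Z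
  have hE : Fintype.card G.Dart = 2 * G.edgeSet.ncard := by
    rw [dart_card_eq_twice_card_edges, ← coe_edgeFinset, Set.ncard_coe_finset]
  unfold excess at hR
  rw [Nat.card_eq_fintype_card (α := V)] at hR
  have hO' : ∑ d : G.Dart, (if H.Adj d.fst d.snd then R.faceWeight d else 1 / 2) =
      (Fintype.card G.Dart : ℚ) / 2 -
        ∑ d : G.Dart with H.Adj d.fst d.snd, (1 / 2 - R.faceWeight d) := by
    rw [Finset.sum_filter, eq_sub_iff_add_eq, ← Finset.sum_add_distrib]
    rw [Finset.sum_congr rfl (g := fun _ => (1 / 2 : ℚ)) fun d _ => by split_ifs <;> ring]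
    rw [Finset.sum_const, Finset.card_univ, nsmul_eq_mul]
    ring
  rw [hO', hE] at hO
  have hint : (2 : ℤ) + G.edgeSet.ncard ≤ R.face.numOrbits + Z.card := by omega
  have hrat : (2 : ℚ) + G.edgeSet.ncard ≤ R.face.numOrbits + Z.card := by exact_mod_cast hint
  push_cast at hO
  linarith

theorem sum_pay_le : ∑ d : G.Dart with H.Adj d.fst d.snd, R.pay Z d ≤
    ∑ d : G.Dart with H.Adj d.fst d.snd, (1 - 4 * R.faceWeight d) +
      ∑ d : G.Dart with R.IsTriDart d, (1 / 3 : ℚ) := by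
  set P : G.Dart → Prop := fun d => R.IsPentaDart d ∧ ¬ R.IsTriDart d with hP
  have hPface : ∀ d, P d ↔ P (R.face d) := by
    intro d
    have h5 : R.IsPentaDart d ↔ R.IsPentaDart (R.face d) := by
      constructor
      · exact fun h => ⟨R.adj_face h.1, by rw [h.2]⟩
      · intro h
        have h5 : R.face (R.face (R.face (R.face (R.face d)))) = d := R.face.injective h.2
        refine ⟨?_, h5⟩
        have := R.adj_face (R.adj_face (R.adj_face (R.adj_face h.1)))
        rwa [h5] at this
    rw [hP]
    simp only [h5, isTriDart_face_iff]
  have hshift : ∀ f : G.Dart → ℚ, ∑ d with P d, f (R.face d) = ∑ d with P d, f d := fun f =>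
    Finset.sum_equiv R.face (fun d => by simp [← hPface]) fun _ _ => rfl
  -- On the faces of length five, the charge sent is averaged over the facial walk.
  have hpenta : ∑ d with P d, R.pay Z d ≤ ∑ d with P d, (1 / 5 : ℚ) := by
    have h1 : ∑ d with P d, (R.pay Z d + R.pay Z (R.face d) + R.pay Z (R.face (R.face d)) +
        R.pay Z (R.face (R.face (R.face d))) +
        R.pay Z (R.face (R.face (R.face (R.face d))))) ≤ ∑ d with P d, (1 : ℚ) :=
      Finset.sum_le_sum fun d hd => penta_pay hH hc (Finset.mem_filter.1 hd).2.1
    simp only [Finset.sum_add_distrib] at h1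
    rw [hshift fun d => R.pay Z (R.face (R.face (R.face d))),
      hshift fun d => R.pay Z (R.face (R.face d)), hshift fun d => R.pay Z (R.face d),
      hshift fun d => R.pay Z d] at h1
    simp only [Finset.sum_const, nsmul_eq_mul] at h1 ⊢
    linarith
  have hle : ∀ d : G.Dart, H.Adj d.fst d.snd → R.pay Z d ≤ (1 - 4 * R.faceWeight d) +
      (if R.IsTriDart d then 1 / 3 else 0) + (if P d then R.pay Z d - 1 / 5 else 0) := by
    intro d _
    unfold faceWeight
    by_cases ht : R.IsTriDart d
    · rw [ht.pay_eq_zero hH hc]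
      simp only [hP, ht, not_true, and_false, if_true, if_false]
      norm_num
    · have := pay_le (R := R) (d := d) hH hc
      by_cases hp : R.IsPentaDart d
      · simp only [hP, ht, hp, not_false_iff, and_self, if_true, if_false]
        linarith
      · simp only [hP, ht, hp, false_and, if_false]
        linarith
  have hsum := Finset.sum_le_sum (s := Finset.univ.filter fun d : G.Dart => H.Adj d.fst d.snd)
    fun d hd => hle d (Finset.mem_filter.1 hd).2
  have e1 : ∑ d : G.Dart with H.Adj d.fst d.snd, (if R.IsTriDart d then (1 / 3 : ℚ) else 0) =
      ∑ d : G.Dart with R.IsTriDart d, (1 / 3 : ℚ) := by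
    rw [← Finset.sum_filter, Finset.filter_filter]
    exact Finset.sum_congr (Finset.filter_congr fun d _ => ⟨fun h => h.2, fun h => ⟨h.1, h⟩⟩)
      fun _ _ => rfl
  have e2 : ∑ d : G.Dart with H.Adj d.fst d.snd, (if P d then R.pay Z d - 1 / 5 else 0) =
      ∑ d with P d, (R.pay Z d - 1 / 5) := by
    rw [← Finset.sum_filter, Finset.filter_filter]
    exact Finset.sum_congr (Finset.filter_congr fun d _ => ⟨fun h => h.2, fun h => ⟨h.1.1, h⟩⟩)
      fun _ _ => rfl
  have e3 : ∑ d with P d, (R.pay Z d - 1 / 5) = ∑ d with P d, R.pay Z d - ∑ d with P d, 1 / 5 :=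
    Finset.sum_sub_distrib _ _
  rw [Finset.sum_add_distrib, Finset.sum_add_distrib, e1, e2, e3] at hsum
  linarith

/-- The vertices that are not on facial triangles end with nonnegative charge. -/
theorem sum_degIn_ge : ∑ d : G.Dart with R.IsTriDart d, ((R.triangleDegree Z d : ℚ) - 12) / 3 ≤
    ∑ v ∈ Z, (((G.degIn Z v : ℚ) - 4) +
      (if G.degIn Z v = 3 ∧ ¬ R.OnTriangle v then 1 else 0)) := by
  have hface : ∀ f : G.Dart → ℚ, ∑ d with R.IsTriDart d, f (R.face d) =
      ∑ d with R.IsTriDart d, f d := fun f =>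
    Finset.sum_equiv R.face (fun d => by simp [isTriDart_face_iff]) fun _ _ => rfl
  have h1 : ∑ d : G.Dart with R.IsTriDart d, ((R.triangleDegree Z d : ℚ) - 12) / 3 =
      ∑ d : G.Dart with R.IsTriDart d, ((G.degIn Z d.fst : ℚ) - 4) := by
    have a : ∑ d : G.Dart with R.IsTriDart d, (G.degIn Z d.snd : ℚ) =
        ∑ d : G.Dart with R.IsTriDart d, (G.degIn Z d.fst : ℚ) := by
      rw [← hface fun d => (G.degIn Z d.fst : ℚ)]
      exact Finset.sum_congr rfl fun d _ => by rw [R.face_fst]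
    have b : ∑ d : G.Dart with R.IsTriDart d, (G.degIn Z (R.face d).snd : ℚ) =
        ∑ d : G.Dart with R.IsTriDart d, (G.degIn Z d.fst : ℚ) := by
      rw [hface fun d => (G.degIn Z d.snd : ℚ), a]
    rw [← Finset.sum_div, Finset.sum_sub_distrib, Finset.sum_sub_distrib]
    unfold triangleDegree
    push_cast
    rw [Finset.sum_add_distrib, Finset.sum_add_distrib, a, b]
    simp only [Finset.sum_const, nsmul_eq_mul]
    ring
  have h2 : ∑ d : G.Dart with R.IsTriDart d, ((G.degIn Z d.fst : ℚ) - 4) =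
      ∑ v ∈ Z with R.OnTriangle v, ((G.degIn Z v : ℚ) - 4) := by
    refine Finset.sum_bij (fun d _ => d.fst) ?_ ?_ ?_ fun _ _ => rfl
    · intro d hd
      have hd := (Finset.mem_filter.1 hd).2
      exact Finset.mem_filter.2 ⟨(hd.mem hH).1, d, hd, rfl⟩
    · intro d hd e he h
      exact (Finset.mem_filter.1 hd).2.eq_of_fst_eq hH hc (Finset.mem_filter.1 he).2 h
    · intro v hv
      obtain ⟨d, hd, h⟩ := (Finset.mem_filter.1 hv).2
      exact ⟨d, Finset.mem_filter.2 ⟨Finset.mem_univ _, hd⟩, h⟩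
  rw [h1, h2, Finset.sum_filter]
  refine Finset.sum_le_sum fun v hv => ?_
  have h3 : (3 : ℚ) ≤ G.degIn Z v := by exact_mod_cast hc.three_le_degIn v hv
  by_cases ht : R.OnTriangle v
  · simp [ht]
  · by_cases hd : G.degIn Z v = 3
    · simp [ht, hd]; norm_num
    · have h4 : (4 : ℚ) ≤ G.degIn Z v := by
        have := hc.three_le_degIn v hv
        exact_mod_cast (by omega : 4 ≤ G.degIn Z v)
      simp [ht, hd, h4]

end SubRotation

/-- In a planar graph, some configuration that can be colored last occurs in each nonempty set of
vertices. -/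
theorem IsCritical.eq_empty (hG : G.IsPlanar) (hc : G.IsCritical Z) : Z = ∅ := by
  by_contra hne
  have hZ := Finset.nonempty_iff_ne_empty.2 hne
  obtain ⟨H, hH, R, hR⟩ : ∃ H : SimpleGraph V, (∀ u v, H.Adj u v ↔ G.Adj u v ∧ u ∈ Z ∧ v ∈ Z) ∧
      ∃ R : SubRotation G H, R.excess ≤ (Nat.card V : ℤ) - (G.edgeSet.ncard : ℤ) :=
    ⟨_, fun u v => by simp [deleteEdges_adj], hG.exists_subRotation {e | ∃ v ∈ e, v ∉ Z}⟩
  have h1 := SubRotation.two_add_sum_le hH hc hZ hR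
  have h2 := SubRotation.sum_pay_le (R := R) hH hc
  have h3 := SubRotation.sum_pay_eq (R := R) hH
  have h4 := SubRotation.sum_degIn_ge (R := R) hH hc
  have hdeg : ∑ v ∈ Z, (G.degIn Z v : ℚ) = ∑ d : G.Dart with H.Adj d.fst d.snd, (1 : ℚ) := by
    rw [SubRotation.sum_darts_eq hH]
    refine Finset.sum_congr rfl fun v hv => ?_
    rw [SubRotation.degIn_eq_card hH v hv, Finset.sum_const, nsmul_eq_mul,
      mul_one]
  have h5 : ∑ d : G.Dart with R.IsTriDart d, (1 / 3 : ℚ) ≤ ∑ d : G.Dart with R.IsTriDart d,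
      (((R.triangleDegree Z d : ℚ) - 12) / 3 + R.need Z d / 3) := by
    refine Finset.sum_le_sum fun d _ => ?_
    have : 13 - (R.triangleDegree Z d : ℚ) ≤ R.need Z d := le_max_right _ _
    linarith
  rw [Finset.sum_add_distrib] at h4 h5
  rw [Finset.sum_sub_distrib, hdeg] at h4
  rw [Finset.sum_sub_distrib] at h1 h2
  rw [← Finset.mul_sum] at h2
  simp only [Finset.sum_const, nsmul_eq_mul] at h1 h2 h4 h5
  linarith

end SimpleGraph

end Discharging

/-! ### Flexibility from reducible configurations -/

section Flexibility

open scoped Classical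

namespace SimpleGraph

variable {V : Type u} {G : SimpleGraph V} {C : Type v}

/-- `ψ` restricts to a proper coloring of the subgraph induced by `S`, with colors from the
lists `M`. -/
def IsColoringOn (G : SimpleGraph V) (M : V → Finset C) (S : Finset V) (ψ : V → C) : Prop :=
  (∀ x ∈ S, ψ x ∈ M x) ∧ ∀ x ∈ S, ∀ y ∈ S, G.Adj x y → ψ x ≠ ψ y

/-- A small set `S ⊆ Z` of vertices that can be colored after the rest of `Z`, with room to spare.
Each vertex of `S` keeps at least two colors of a list of size four, and `S` can still be colored if
all of its vertices except one have two colors left, and this one has one color left. No two vertices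
of `S` have a common neighbor outside `Z`, so that a vertex which is colored later restricts only one
vertex of `S` at a time. -/
structure IsReducible (G : SimpleGraph V) (C : Type v) (Z S : Finset V) : Prop where
  nonempty : S.Nonempty
  subset : S ⊆ Z
  card_le : S.card ≤ 3
  degIn_sdiff_le : ∀ x ∈ S, G.degIn (Z \ S) x ≤ 2
  eq_of_adj : ∀ z ∉ Z, ∀ x ∈ S, ∀ y ∈ S, G.Adj z x → G.Adj z y → x = y
  exists_coloring : ∀ (M : V → Finset C) (v : V), (∀ x ∈ S, (M x).Nonempty) →
    (∀ x ∈ S, x ≠ v → 2 ≤ (M x).card) → ∃ ψ, G.IsColoringOn M S ψ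

section Extend

variable (G) (L : V → Finset C) (Z S : Finset V) (φ : V → C)

/-- The colors in the list of `x` that do not occur on the neighbors of `x` in `Z \ S`. -/
noncomputable def available (x : V) : Finset C :=
  (L x).filter fun c => ∀ y ∈ Z \ S, G.Adj x y → φ y ≠ c

/-- The extensions of the coloring `φ` of `Z \ S` to `Z`. -/
def extensions : Set (V → C) :=
  {ψ | G.IsColoringOn L Z ψ ∧ ∀ x ∉ S, ψ x = φ x}

variable {G L Z S φ}

theorem card_le_card_available_add (x : V) :
    (L x).card ≤ (G.available L Z S φ x).card + G.degIn (Z \ S) x := by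
  have : L x ⊆ G.available L Z S φ x ∪ ((Z \ S).filter (G.Adj x)).image φ := by
    intro c hc
    by_cases h : ∀ y ∈ Z \ S, G.Adj x y → φ y ≠ c
    · exact Finset.mem_union_left _ (Finset.mem_filter.2 ⟨hc, h⟩)
    · push Not at h
      obtain ⟨y, hy, hxy, rfl⟩ := h
      exact Finset.mem_union_right _ (Finset.mem_image_of_mem _ (Finset.mem_filter.2 ⟨hy, hxy⟩))
  calc (L x).card ≤ _ := Finset.card_le_card this
    _ ≤ _ := Finset.card_union_le _ _
    _ ≤ _ := Nat.add_le_add_left Finset.card_image_le _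

theorem exists_mem_extensions {M : V → Finset C} {ψ : V → C}
    (hφ : G.IsColoringOn L (Z \ S) φ) (hM : ∀ x ∈ S, M x ⊆ G.available L Z S φ x)
    (hψ : G.IsColoringOn M S ψ) : (fun x => if x ∈ S then ψ x else φ x) ∈ G.extensions L Z S φ := by
  have hav : ∀ x ∈ S, ψ x ∈ L x ∧ ∀ y ∈ Z \ S, G.Adj x y → φ y ≠ ψ x := fun x hx =>
    Finset.mem_filter.1 (hM x hx (hψ.1 x hx))
  refine ⟨⟨fun x hx => ?_, fun x hx y hy hxy => ?_⟩, fun x hx => if_neg hx⟩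
  · by_cases h : x ∈ S
    · simpa [h] using (hav x h).1
    · simpa [h] using hφ.1 x (Finset.mem_sdiff.2 ⟨hx, h⟩)
  · by_cases h : x ∈ S <;> by_cases h' : y ∈ S
    · simpa [h, h'] using hψ.2 x h y h' hxy
    · simpa [h, h'] using ((hav x h).2 y (Finset.mem_sdiff.2 ⟨hy, h'⟩) hxy).symm
    · simpa [h, h'] using (hav y h').2 x (Finset.mem_sdiff.2 ⟨hx, h⟩) hxy.symm
    · simpa [h, h'] using hφ.2 x (Finset.mem_sdiff.2 ⟨hx, h⟩) y (Finset.mem_sdiff.2 ⟨hy, h'⟩) hxy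

/-- A coloring has at most `4 ^ 3 = 64` extensions to three vertices. -/
theorem exists_enum_extensions (hL : ∀ x, (L x).card = 4) (hSZ : S ⊆ Z) (hS : S.card ≤ 3)
    (hne : (G.extensions L Z S φ).Nonempty) :
    ∃ g : Fin 64 → V → C, (∀ i, g i ∈ G.extensions L Z S φ) ∧
      ∀ ψ ∈ G.extensions L Z S φ, ∃ i, g i = ψ := by
  let r : G.extensions L Z S φ → (∀ x : S, L x) := fun ψ x => ⟨ψ.1 x, ψ.2.1.1 x (hSZ x.2)⟩
  have hr : Function.Injective r := by
    intro ψ ψ' h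
    refine Subtype.ext (funext fun x => ?_)
    by_cases hx : x ∈ S
    · exact congrArg Subtype.val (congrFun h ⟨x, hx⟩)
    · rw [ψ.2.2 x hx, ψ'.2.2 x hx]
  have : Finite (G.extensions L Z S φ) := Finite.of_injective r hr
  have hcard : Nat.card (G.extensions L Z S φ) ≤ 64 := by
    refine (Nat.card_le_card_of_injective r hr).trans ?_
    rw [Nat.card_pi]
    simp only [Nat.card_eq_fintype_card, Fintype.card_coe, hL, Finset.prod_const, Finset.card_univ]
    exact (Nat.pow_le_pow_right (by norm_num) hS).trans (by norm_num)
  have := Fintype.ofFinite (G.extensions L Z S φ)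
  rw [Nat.card_eq_fintype_card] at hcard
  obtain ⟨e⟩ := Function.Embedding.nonempty_of_card_le
    (hcard.trans_eq (Fintype.card_fin 64).symm)
  have := hne.to_subtype
  refine ⟨fun i => (Function.invFun e i).1, fun i => (Function.invFun e i).2, fun ψ hψ =>
    ⟨e ⟨ψ, hψ⟩, ?_⟩⟩
  simp only
  rw [Function.leftInverse_invFun e.injective]

end Extend

/-- There is a finite family of colorings of `Z` such that, for a uniformly random member of it, each
vertex receives each color of its list with probability at least `64⁻³`, and a set `I` of neighbors
of a vertex outside `Z` avoids any given color with probability at least `64 ^ (-|I|)`. -/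
def HasSpreadFamily (G : SimpleGraph V) (L : V → Finset C) (Z : Finset V) : Prop :=
  ∃ (Ω : Type) (_ : Fintype Ω) (_ : Nonempty Ω) (φ : Ω → V → C),
    (∀ ω, G.IsColoringOn L Z (φ ω)) ∧
    (∀ x ∈ Z, ∀ c ∈ L x,
      Fintype.card Ω ≤ 64 ^ 3 * (Finset.univ.filter fun ω => φ ω x = c).card) ∧
    ∀ I ⊆ Z, ∀ z ∉ Z, (∀ x ∈ I, G.Adj z x) → ∀ c,
      Fintype.card Ω ≤ 64 ^ I.card * (Finset.univ.filter fun ω => ∀ x ∈ I, φ ω x ≠ c).card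

theorem IsReducible.hasSpreadFamily {L : V → Finset C} {Z S : Finset V}
    (hL : ∀ x, (L x).card = 4) (hS : G.IsReducible C Z S)
    (h : G.HasSpreadFamily L (Z \ S)) : G.HasSpreadFamily L Z := by
  obtain ⟨Ω, _, _, φ, hφ, hcol, havoid⟩ := h
  have hav : ∀ ω, ∀ x ∈ S, 2 ≤ (G.available L Z S (φ ω) x).card := fun ω x hx => by
    have h1 := card_le_card_available_add (G := G) (L := L) (Z := Z) (S := S) (φ := φ ω) x
    have h2 := hS.degIn_sdiff_le x hx
    rw [hL] at h1
    omega
  -- A color that is not used on the neighbors of `x` outside `S` can be given to `x ∈ S`.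
  have hfix : ∀ ω, ∀ x ∈ S, ∀ c ∈ G.available L Z S (φ ω) x,
      ∃ ψ ∈ G.extensions L Z S (φ ω), ψ x = c := by
    intro ω x hx c hc
    obtain ⟨ψ, hψ⟩ := hS.exists_coloring
      (fun y => if y = x then {c} else G.available L Z S (φ ω) y) x
      (fun y hy => by
        split_ifs
        · exact Finset.singleton_nonempty c
        · exact Finset.card_pos.1 (by have := hav ω y hy; omega))
      (fun y hy hyx => by simpa [hyx] using hav ω y hy)
    refine ⟨_, exists_mem_extensions (hφ ω) (fun y hy => ?_) hψ, ?_⟩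
    · split_ifs with hyx
      · rw [hyx]; exact Finset.singleton_subset_iff.2 hc
      · exact Finset.Subset.refl _
    · have := hψ.1 x hx
      simpa [hx] using this
  -- A color can be avoided on the neighbors in `S` of a vertex outside `Z`.
  have hforb : ∀ ω, ∀ z ∉ Z, ∀ c,
      ∃ ψ ∈ G.extensions L Z S (φ ω), ∀ x ∈ S, G.Adj z x → ψ x ≠ c := by
    intro ω z hz c
    obtain ⟨v, hv⟩ : ∃ v, ∀ x ∈ S, x ≠ v → ¬ G.Adj z x := by
      by_cases hex : ∃ v ∈ S, G.Adj z v
      · obtain ⟨v, hv, hzv⟩ := hex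
        exact ⟨v, fun x hx hxv hzx => hxv (hS.eq_of_adj z hz x hx v hv hzx hzv)⟩
      · push Not at hex
        exact ⟨z, fun x hx _ => hex x hx⟩
    obtain ⟨ψ, hψ⟩ := hS.exists_coloring
      (fun y => if G.Adj z y then (G.available L Z S (φ ω) y).erase c
        else G.available L Z S (φ ω) y) v
      (fun y hy => Finset.card_pos.1 (by
        have h2 := hav ω y hy
        have h3 := Finset.pred_card_le_card_erase (s := G.available L Z S (φ ω) y) (a := c)
        split_ifs <;> omega))
      (fun y hy hyv => by simpa [hv y hy hyv] using hav ω y hy)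
    refine ⟨_, exists_mem_extensions (hφ ω) (fun y hy => ?_) hψ, fun x hx hzx => ?_⟩
    · split_ifs
      · exact Finset.erase_subset _ _
      · exact Finset.Subset.refl _
    · have := hψ.1 x hx
      simp only [hzx, if_true, Finset.mem_erase] at this
      simpa [hx] using this.1
  have hne : ∀ ω, (G.extensions L Z S (φ ω)).Nonempty := fun ω => by
    obtain ⟨x, hx⟩ := hS.nonempty
    obtain ⟨c, hc⟩ := Finset.card_pos.1 (show 0 < (G.available L Z S (φ ω) x).card by
      have := hav ω x hx; omega)
    obtain ⟨ψ, hψ, -⟩ := hfix ω x hx c hc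
    exact ⟨ψ, hψ⟩
  choose g hg hg' using fun ω => exists_enum_extensions hL hS.subset hS.card_le (hne ω)
  have hcard : Fintype.card (Ω × Fin 64) = 64 * Fintype.card Ω := by
    rw [Fintype.card_prod, Fintype.card_fin, mul_comm]
  -- An event that some extension satisfies loses a factor of at most `64` in probability.
  have hext : ∀ (Q : Ω → Prop) (P : (V → C) → Prop) [DecidablePred Q]
      [DecidablePred fun p : Ω × Fin 64 => P (g p.1 p.2)],
      (∀ ω, Q ω → ∃ ψ ∈ G.extensions L Z S (φ ω), P ψ) →
      (Finset.univ.filter Q).card ≤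
        (Finset.univ.filter fun p : Ω × Fin 64 => P (g p.1 p.2)).card := by
    intro Q P _ _ hQP
    have : ∀ ω, ∃ i, Q ω → P (g ω i) := fun ω => by
      by_cases hω : Q ω
      · obtain ⟨ψ, hψ, hP⟩ := hQP ω hω
        obtain ⟨i, rfl⟩ := hg' ω ψ hψ
        exact ⟨i, fun _ => hP⟩
      · exact ⟨0, fun h => absurd h hω⟩
    choose i hi using this
    refine Finset.card_le_card_of_injOn (fun ω => (ω, i ω)) (fun ω hω => ?_)
      fun ω _ ω' _ h => congrArg Prod.fst h
    simp only [Finset.coe_filter, Finset.mem_univ, true_and, Set.mem_ofPred_eq] at hω ⊢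
    exact hi ω hω
  -- An event that does not depend on `S` keeps its probability.
  have hold : ∀ (Q : Ω → Prop) (P : (V → C) → Prop) [DecidablePred Q]
      [DecidablePred fun p : Ω × Fin 64 => P (g p.1 p.2)], (∀ ω i, P (g ω i) ↔ Q ω) →
      (Finset.univ.filter fun p : Ω × Fin 64 => P (g p.1 p.2)).card =
        64 * (Finset.univ.filter Q).card := by
    intro Q P _ _ hQP
    have : (Finset.univ.filter fun p : Ω × Fin 64 => P (g p.1 p.2)) =
        Finset.univ.filter Q ×ˢ (Finset.univ : Finset (Fin 64)) := by
      ext p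
      simp [hQP]
    rw [this, Finset.card_product, Finset.card_univ, Fintype.card_fin, mul_comm]
  have aux : ∀ {n p q a b : ℕ}, n ≤ p * a → a ≤ b → p * 64 ≤ q → 64 * n ≤ q * b := by
    intro n p q a b h1 h2 h3
    calc 64 * n ≤ 64 * (p * a) := Nat.mul_le_mul_left _ h1
      _ = p * 64 * a := by ring
      _ ≤ q * b := Nat.mul_le_mul h3 h2
  refine ⟨Ω × Fin 64, inferInstance, inferInstance, fun p => g p.1 p.2, fun p => (hg p.1 p.2).1,
    fun x hx c hc => ?_, fun I hI z hz hzI c => ?_⟩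
  · rw [hcard]
    beta_reduce
    by_cases hxS : x ∈ S
    · have h1 := havoid ((Z \ S).filter (G.Adj x)) (Finset.filter_subset _ _) x
        (fun h => (Finset.mem_sdiff.1 h).2 hxS) (fun y hy => (Finset.mem_filter.1 hy).2) c
      have h2 : 64 ^ ((Z \ S).filter (G.Adj x)).card ≤ 64 ^ 2 :=
        Nat.pow_le_pow_right (by norm_num) (hS.degIn_sdiff_le x hxS)
      have h3 := hext (fun ω => ∀ y ∈ (Z \ S).filter (G.Adj x), φ ω y ≠ c) (fun ψ => ψ x = c)
        fun ω hω => hfix ω x hxS c (Finset.mem_filter.2 ⟨hc, fun y hy hxy =>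
          hω y (Finset.mem_filter.2 ⟨hy, hxy⟩)⟩)
      exact aux (h1.trans (Nat.mul_le_mul_right _ h2)) h3 (by norm_num)
    · rw [hold (fun ω => φ ω x = c) (fun ψ => ψ x = c) fun ω i => by rw [(hg ω i).2 x hxS]]
      have := hcol x (Finset.mem_sdiff.2 ⟨hx, hxS⟩) c hc
      linarith
  · rw [hcard]
    beta_reduce
    have hI' : I \ S ⊆ Z \ S := Finset.sdiff_subset_sdiff hI (Finset.Subset.refl _)
    have h1 := havoid (I \ S) hI' z (fun h => hz (Finset.mem_sdiff.1 h).1)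
      (fun x hx => hzI x (Finset.mem_sdiff.1 hx).1) c
    by_cases hIS : I ∩ S = ∅
    · rw [Finset.sdiff_eq_self_iff_disjoint.2 (Finset.disjoint_iff_inter_eq_empty.2 hIS)] at h1
      have hxS : ∀ x ∈ I, x ∉ S := fun x hx hxS =>
        Finset.notMem_empty x (hIS ▸ Finset.mem_inter.2 ⟨hx, hxS⟩)
      rw [hold (fun ω => ∀ x ∈ I, φ ω x ≠ c) (fun ψ => ∀ x ∈ I, ψ x ≠ c) fun ω i =>
        forall₂_congr fun x hx => by rw [(hg ω i).2 x (hxS x hx)]]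
      linarith
    · have hlt : (I \ S).card + 1 ≤ I.card := by
        have := Finset.card_sdiff_add_card_inter I S
        have := Finset.card_pos.2 (Finset.nonempty_iff_ne_empty.2 hIS)
        omega
      have h3 := hext (fun ω => ∀ x ∈ I \ S, φ ω x ≠ c) (fun ψ => ∀ x ∈ I, ψ x ≠ c)
        fun ω hω => by
          obtain ⟨ψ, hψ, hψc⟩ := hforb ω z hz c
          refine ⟨ψ, hψ, fun x hx => ?_⟩
          by_cases hxS : x ∈ S
          · exact hψc x hxS (hzI x hx)
          · rw [hψ.2 x hxS]
            exact hω x (Finset.mem_sdiff.2 ⟨hx, hxS⟩)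
      exact aux h1 h3 ((pow_succ 64 _).symm.trans_le (Nat.pow_le_pow_right (by norm_num) hlt))

theorem hasSpreadFamily_of_isReducible {L : V → Finset C} (hL : ∀ x, (L x).card = 4)
    (h : ∀ Z : Finset V, Z.Nonempty → ∃ S, G.IsReducible C Z S) (Z : Finset V) :
    G.HasSpreadFamily L Z := by
  induction Z using Finset.strongInduction with
  | _ Z ih =>
    rcases Z.eq_empty_or_nonempty with rfl | hZ
    · have : ∀ x, ∃ c, c ∈ L x := fun x => Finset.card_pos.1 (by rw [hL]; norm_num)
      choose φ hφ using this
      refine ⟨Unit, inferInstance, inferInstance, fun _ => φ, fun _ => ?_, fun x hx => ?_,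
        fun I hI z hz hzI c => ?_⟩
      · exact ⟨fun x hx => absurd hx (Finset.notMem_empty x),
          fun x hx => absurd hx (Finset.notMem_empty x)⟩
      · exact absurd hx (Finset.notMem_empty x)
      · simp [Finset.subset_empty.1 hI]
    · obtain ⟨S, hS⟩ := h Z hZ
      exact hS.hasSpreadFamily hL (ih _ (Finset.sdiff_ssubset hS.subset hS.nonempty))

theorem HasSpreadFamily.isWeightedFlexibleWith [Fintype V] {L : V → Finset C}
    (h : G.HasSpreadFamily L Finset.univ) : G.IsWeightedFlexibleWith L (1 / 64 ^ 3) := by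
  intro w hw
  obtain ⟨Ω, _, _, φ, hφ, hcol, -⟩ := h
  have hsum : ∑ _ω : Ω, 1 / 64 ^ 3 * ∑ x, ∑ c ∈ L x, w x c ≤ ∑ ω, ∑ x, w x (φ ω x) := by
    have h1 : ∑ ω, ∑ x, w x (φ ω x) =
        ∑ x, ∑ c ∈ L x, (Finset.univ.filter fun ω => φ ω x = c).card * w x c := by
      rw [Finset.sum_comm]
      refine Finset.sum_congr rfl fun x _ => ?_
      rw [← Finset.sum_fiberwise_of_maps_to (t := L x) (g := fun ω => φ ω x) fun ω _ =>
        (hφ ω).1 x (Finset.mem_univ x)]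
      refine Finset.sum_congr rfl fun c _ => ?_
      rw [Finset.sum_congr rfl (g := fun _ => w x c) fun ω hω => by
        rw [(Finset.mem_filter.1 hω).2], Finset.sum_const, nsmul_eq_mul]
    rw [h1, Finset.sum_const, nsmul_eq_mul, Finset.mul_sum, Finset.mul_sum]
    refine Finset.sum_le_sum fun x _ => ?_
    rw [Finset.mul_sum, Finset.mul_sum]
    refine Finset.sum_le_sum fun c hc => ?_
    rw [← mul_assoc]
    refine mul_le_mul_of_nonneg_right ?_ (hw x c hc)
    have : (Fintype.card Ω : ℝ) ≤ 64 ^ 3 * ((Finset.univ.filter fun ω => φ ω x = c).card : ℝ) := by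
      exact_mod_cast hcol x (Finset.mem_univ x) c hc
    rw [Finset.card_univ]
    linarith
  obtain ⟨ω, -, hω⟩ := Finset.exists_le_of_sum_le Finset.univ_nonempty hsum
  exact ⟨Coloring.mk (φ ω) fun {x y} hxy =>
    (hφ ω).2 x (Finset.mem_univ x) y (Finset.mem_univ y) hxy,
    fun x => (hφ ω).1 x (Finset.mem_univ x), hω⟩

end SimpleGraph

end Flexibility

/-! ### The reducible configurations -/

section Configurations

open scoped Classical

namespace SimpleGraph

variable {V : Type u} {G : SimpleGraph V} {C : Type v} {Z S : Finset V}

theorem degIn_sdiff_add_card_le {T : Finset V} {x : V} (hTS : T ⊆ S) (hTZ : T ⊆ Z)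
    (h : ∀ y ∈ T, G.Adj x y) : G.degIn (Z \ S) x + T.card ≤ G.degIn Z x := by
  unfold degIn
  rw [← Finset.card_union_of_disjoint]
  · refine Finset.card_le_card (Finset.union_subset ?_ fun y hy => ?_)
    · exact Finset.filter_subset_filter _ Finset.sdiff_subset
    · exact Finset.mem_filter.2 ⟨hTZ hy, h y hy⟩
  · rw [Finset.disjoint_left]
    intro y hy hyT
    exact (Finset.mem_sdiff.1 (Finset.mem_filter.1 hy).1).2 (hTS hyT)

theorem isReducible_singleton {x : V} (hx : x ∈ Z) (h : G.degIn Z x ≤ 2) :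
    G.IsReducible C Z {x} where
  nonempty := Finset.singleton_nonempty x
  subset := Finset.singleton_subset_iff.2 hx
  card_le := by simp
  degIn_sdiff_le y hy := by
    rw [Finset.mem_singleton.1 hy]
    have := G.degIn_sdiff_add_card_le (Z := Z) (S := {x}) (T := ∅) (x := x) (by simp) (by simp)
      (by simp)
    exact le_trans this h
  eq_of_adj z _ y hy y' hy' _ _ := by
    rw [Finset.mem_singleton.1 hy, Finset.mem_singleton.1 hy']
  exists_coloring M v hM _ := by
    obtain ⟨c, hc⟩ := hM x (Finset.mem_singleton_self x)
    refine ⟨fun _ => c, fun y hy => ?_, fun y hy y' hy' hadj => ?_⟩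
    · rw [Finset.mem_singleton.1 hy]; exact hc
    · rw [Finset.mem_singleton.1 hy, Finset.mem_singleton.1 hy'] at hadj
      exact absurd hadj (G.irrefl)

theorem isReducible_edge {x y : V} (hx : x ∈ Z) (hy : y ∈ Z) (hxy : G.Adj x y)
    (hdx : G.degIn Z x = 3) (hdy : G.degIn Z y = 3) (h : ∀ z ∉ Z, G.Adj z x → ¬ G.Adj z y) :
    G.IsReducible C Z {x, y} where
  nonempty := Finset.insert_nonempty _ _
  subset := by simp [Finset.insert_subset_iff, hx, hy]
  card_le := Finset.card_le_two.trans (by norm_num)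
  degIn_sdiff_le v hv := by
    rcases Finset.mem_insert.1 hv with rfl | hv
    · have := G.degIn_sdiff_add_card_le (Z := Z) (S := {v, y}) (T := {y}) (x := v) (by simp)
        (by simpa using hy) (by simpa using hxy)
      rw [Finset.card_singleton] at this
      omega
    · rw [Finset.mem_singleton.1 hv]
      have := G.degIn_sdiff_add_card_le (Z := Z) (S := {x, y}) (T := {x}) (x := y) (by simp)
        (by simpa using hx) (by simpa using hxy.symm)
      rw [Finset.card_singleton] at this
      omega
  eq_of_adj z hz a ha b hb hza hzb := by
    simp only [Finset.mem_insert, Finset.mem_singleton] at ha hb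
    rcases ha with rfl | rfl <;> rcases hb with rfl | rfl
    exacts [rfl, absurd hzb (h z hz hza), absurd hza (h z hz hzb), rfl]
  exists_coloring M v hM hM2 := by
    obtain ⟨c, hc, d, hd, hcd⟩ : ∃ c ∈ M x, ∃ d ∈ M y, c ≠ d := by
      by_cases hv : x = v
      · obtain ⟨c, hc⟩ := hM x (by simp)
        obtain ⟨d, hd, hdc⟩ := Finset.exists_mem_ne
          (hM2 y (by simp) fun h => hxy.ne (hv.trans h.symm)) c
        exact ⟨c, hc, d, hd, hdc.symm⟩
      · obtain ⟨d, hd⟩ := hM y (by simp)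
        obtain ⟨c, hc, hcd⟩ := Finset.exists_mem_ne (hM2 x (by simp) hv) d
        exact ⟨c, hc, d, hd, hcd⟩
    have hyx := hxy.ne'
    refine ⟨fun w => if w = x then c else d, ?_, ?_⟩
    · simp [hc, hd, hyx]
    · simp [hyx, hcd, hcd.symm]

theorem isReducible_path {x y w : V} (hx : x ∈ Z) (hy : y ∈ Z) (hw : w ∈ Z) (hxy : G.Adj x y)
    (hyw : G.Adj y w) (hxw : x ≠ w) (hnxw : ¬ G.Adj x w)
    (hdx : G.degIn Z x = 3) (hdy : G.degIn Z y = 4) (hdw : G.degIn Z w = 3)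
    (h1 : ∀ z ∉ Z, G.Adj z x → ¬ G.Adj z y) (h2 : ∀ z ∉ Z, G.Adj z y → ¬ G.Adj z w)
    (h3 : ∀ z ∉ Z, G.Adj z x → ¬ G.Adj z w) :
    G.IsReducible C Z {x, y, w} where
  nonempty := Finset.insert_nonempty _ _
  subset := by simp [Finset.insert_subset_iff, hx, hy, hw]
  card_le := Finset.card_le_three
  degIn_sdiff_le v hv := by
    simp only [Finset.mem_insert, Finset.mem_singleton] at hv
    rcases hv with rfl | rfl | rfl
    · have := G.degIn_sdiff_add_card_le (Z := Z) (S := {v, y, w}) (T := {y}) (x := v) (by simp)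
        (by simpa using hy) (by simpa using hxy)
      rw [Finset.card_singleton] at this
      omega
    · have := G.degIn_sdiff_add_card_le (Z := Z) (S := {x, v, w}) (T := {x, w}) (x := v)
        (by intro a; simp; tauto) (by simp [Finset.insert_subset_iff, hx, hw])
        (by simp [hxy.symm, hyw])
      rw [Finset.card_pair hxw] at this
      omega
    · have := G.degIn_sdiff_add_card_le (Z := Z) (S := {x, y, v}) (T := {y}) (x := v) (by simp)
        (by simpa using hy) (by simpa using hyw.symm)
      rw [Finset.card_singleton] at this
      omega
  eq_of_adj z hz a ha b hb hza hzb := by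
    simp only [Finset.mem_insert, Finset.mem_singleton] at ha hb
    rcases ha with rfl | rfl | rfl <;> rcases hb with rfl | rfl | rfl
    exacts [rfl, absurd hzb (h1 z hz hza), absurd hzb (h3 z hz hza), absurd hza (h1 z hz hzb), rfl,
      absurd hzb (h2 z hz hza), absurd hza (h3 z hz hzb), absurd hza (h2 z hz hzb), rfl]
  exists_coloring M v hM hM2 := by
    have hyx := hxy.ne'
    have hwy := hyw.ne'
    -- A vertex with a single color is colored before its neighbors.
    obtain ⟨c, hc, d, hd, e, he, hcd, hde⟩ :
        ∃ c ∈ M x, ∃ d ∈ M y, ∃ e ∈ M w, c ≠ d ∧ d ≠ e := by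
      by_cases hv : x = v
      · obtain ⟨c, hc⟩ := hM x (by simp)
        obtain ⟨d, hd, hdc⟩ := Finset.exists_mem_ne (hM2 y (by simp) (hv ▸ hyx)) c
        obtain ⟨e, he, hed⟩ := Finset.exists_mem_ne (hM2 w (by simp) (hv ▸ hxw.symm)) d
        exact ⟨c, hc, d, hd, e, he, hdc.symm, hed.symm⟩
      by_cases hv' : y = v
      · obtain ⟨d, hd⟩ := hM y (by simp)
        obtain ⟨c, hc, hcd⟩ := Finset.exists_mem_ne (hM2 x (by simp) hv) d
        obtain ⟨e, he, hed⟩ := Finset.exists_mem_ne (hM2 w (by simp) (hv' ▸ hwy)) d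
        exact ⟨c, hc, d, hd, e, he, hcd, hed.symm⟩
      · obtain ⟨e, he⟩ := hM w (by simp)
        obtain ⟨d, hd, hde⟩ := Finset.exists_mem_ne (hM2 y (by simp) hv') e
        obtain ⟨c, hc, hcd⟩ := Finset.exists_mem_ne (hM2 x (by simp) hv) d
        exact ⟨c, hc, d, hd, e, he, hcd, hde⟩
    have hnwx : ¬ G.Adj w x := fun h => hnxw h.symm
    refine ⟨fun v => if v = x then c else if v = y then d else e, ?_, ?_⟩
    · simp [hc, hd, he, hyx, hwy, hxw.symm]
    · simp [hyx, hwy, hxw.symm, hcd, hcd.symm, hde, hde.symm, hnxw, hnwx]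

theorem exists_isReducible [Fintype V] (hG : G.IsPlanar) (h4 : (cycleGraph 4).Free G)
    (h3 : G.TriangleDistanceAtLeast 2) (hZ : Z.Nonempty) : ∃ S, G.IsReducible C Z S := by
  by_contra hno
  push Not at hno
  have no4 : ∀ a b c d, G.Adj a b → G.Adj b c → G.Adj c d → G.Adj d a → a ≠ c → b = d := by
    intro a b c d hab hbc hcd hda hac
    by_contra hbd
    refine h4 ⟨⟨⟨![a, b, c, d], fun {i j} hij => ?_⟩, fun i j hij => ?_⟩⟩
    · rw [cycleGraph_adj] at hij
      fin_cases i <;> fin_cases j <;>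
        first
        | exact absurd hij (by decide)
        | simp [hab, hbc, hcd, hda, hab.symm, hbc.symm, hcd.symm, hda.symm]
    · have := hab.ne; have := hbc.ne; have := hcd.ne; have := hda.ne
      fin_cases i <;> fin_cases j <;> simp_all [eq_comm]
  have hc : G.IsCritical Z := by
    refine ⟨no4, fun s t hs ht x hx y hy hxy => ?_, fun v hv => ?_, fun x hx y hy hxy hdx hdy => ?_,
      fun x hx y hy w hw hxy hyw hxw hnxw hdx hdy hdw => ?_⟩
    · by_contra hst
      have h := h3 s t hs ht hst x hx y hy
      rcases hxy with rfl | hxy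
      · rw [edist_self] at h
        exact absurd h (by norm_num)
      · rw [edist_eq_one_iff_adj.2 hxy] at h
        exact absurd h (by norm_num)
    · by_contra hlt
      exact hno _ (isReducible_singleton hv (by omega))
    · by_contra hex
      push Not at hex
      exact hno _ (isReducible_edge hx hy hxy hdx hdy hex)
    · by_contra hex
      push Not at hex
      refine hno _ (isReducible_path hx hy hw hxy hyw hxw hnxw hdx hdy hdw hex.1 hex.2
        fun z hz hzx hzw => hxw ?_)
      -- Otherwise `z`, `x`, `y` and `w` form a four-cycle.
      exact no4 z x y w hzx hxy hyw hzw.symm fun h => hz (h ▸ hy)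
  exact hZ.ne_empty (hc.eq_empty hG)

end SimpleGraph

end Configurations

theorem theorem1p4 :
    ∃ ε : ℝ, 0 < ε ∧
      ∀ (V : Type u) [Fintype V] (G : SimpleGraph V),
        G.IsPlanar → (SimpleGraph.cycleGraph 4).Free G → G.TriangleDistanceAtLeast 2 →
          SimpleGraph.IsWeightedFlexible.{u, v} G ε 4 := by
  refine ⟨1 / 64 ^ 3, by positivity, fun V _ G hG h4 h3 C L hL => ?_⟩
  exact (SimpleGraph.hasSpreadFamily_of_isReducible hL
    (fun _ hZ => SimpleGraph.exists_isReducible hG h4 h3 hZ) Finset.univ).isWeightedFlexibleWith
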